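/- Let $d<M$ be natural numbers and $Q=[0,2\pi)^M$. Let $B=(b_{kl})_{k,l=1}^d$ be a real matrix function on $\mathbb{R}^M$ with smooth $Q$-periodic entries, let $\Lambda$ be a constant real $M\times d$ matrix with $\Lambda^Tp\neq0$ for all nonzero $p\in\mathbb{Z}^M$, and suppose that the (smooth, bounded) quasiperiodic matrix $A(x)=B(\Lambda x)$, $x\in\mathbb{R}^d$, is symmetric and coercive, i.e. there is $\alpha>0$ such that $\langle A(x)v,v\rangle\ge\alpha\|v\|^2$ for all $v\in\mathbb{R}^d$ and a.e. $x\in\mathbb{R}^d$. Let $0<\delta<1$ and $D=\Lambda^T\nabla_y$. Let $H^1_\sharp(Q)$ be the space of complex $Q$-periodic $L^2$ functions whose periodic distributional first derivatives are in $L^2(Q)$, and for $\eta\in\mathbb{R}^d$ let $$\mathcal{C}^\delta(\eta)=-(D+i\eta)\cdot B(D+i\eta)-\delta\Delta,$$ understood through its form $a^\delta[\eta](u,v)=\int_Q B(D+i\eta)u\cdot\overline{(D+i\eta)v}\,dy+\delta\int_Q\nabla u\cdot\overline{\nabla v}\,dy$ on $H^1_\sharp(Q)$. Let $\lambda_1^\delta(\eta)$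 be the smallest eigenvalue of $\mathcal{C}^\delta(\eta)$ (the first regularized Bloch eigenvalue). For $l=1,\dots,d$ let the regularized cell problem be the weak form in $H^1_\sharp(Q)$ of $$-D\cdot B\,D\psi_l^\delta-\delta\Delta\psi_l^\delta=D\cdot Be_l ,$$ and let $$q^{\delta,*}_{kl}=\frac{1}{(2\pi)^M}\int_Q\left(b_{kl}+e_k\cdot B\,D\psi_l^\delta\right)dy .$$ Then, for $\eta$ in a neighbourhood of $0$, the smallest eigenvalue $\lambda_1^\delta(\eta)$ exists; it is real analytic at $\eta=0$; there is a family of eigenfunctions $\phi_1^\delta(\cdot;\eta)\in H^1_\sharp(Q)\setminus\{0\}$ for the eigenvalues $\lambda_1^\delta(\eta)$ that is analytic at $\eta=0$ with values in $H^1_\sharp(Q)$; each regularized cell problem has a real-valued solution $\psi_l^\delta$; and the following holds. 1. $\lambda_1^\delta(0)=0$. 2. $\dfrac{\partial\lambda_1^\delta}{\partial\eta_l}(0)=0$ for all $l=1,\dots,d$. 3. For every family $\phi_1^\delta(\cdot;\eta)\in H^1_\sharp(Q)\setminus\{0\}$, $\eta$ near $0$, of eigenfunctions for $\lambda_1^\delta(\eta)$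 that is differentiable at $\eta=0$ with values in $H^1_\sharp(Q)$, for every $l$ and every solution $\psi_l^\delta$ of the $l$-th regularized cell problem, the function $y\mapsto\dfrac{\partial\phi_1^\delta}{\partial\eta_l}(y;0)-i\,\phi_1^\delta(y;0)\,\psi_l^\delta(y)$ is (a.e.) constant in $y$. 4. For all $k,l$ and every solution $\psi_l^\delta$ of the $l$-th regularized cell problem, $\dfrac12\dfrac{\partial^2\lambda_1^\delta}{\partial\eta_k\partial\eta_l}(0)=q^{\delta,*}_{kl}$. -/

import Mathlib

open MeasureTheory Filter Topology
open scoped ContDiff Matrix ComplexConjugate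

noncomputable section

namespace QPBloch

/-- The periodicity cell `Q = [0, 2π)^M`. -/
def cell (M : ℕ) : Set (Fin M → ℝ) :=
  Set.pi Set.univ fun _ => Set.Ico 0 (2 * Real.pi)

/-- The standing assumptions on the coefficients: `A = B ∘ Λ` is smooth and bounded, where `B` is
smooth and `Q`-periodic and `Λ` has irrational slope (`Λᵀ p ≠ 0` for nonzero integer `p`), and `A`
(not `B`) is symmetric and coercive. Here `v ⬝ᵥ v` is the squared Euclidean norm of `v`. -/
structure IsQuasiperiodicCoeff {d M : ℕ} (A : (Fin d → ℝ) → Matrix (Fin d) (Fin d) ℝ)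
    (B : (Fin M → ℝ) → Matrix (Fin d) (Fin d) ℝ) (Λ : Matrix (Fin M) (Fin d) ℝ) : Prop where
  smooth : ∀ k l, ContDiff ℝ ∞ fun x => A x k l
  bounded : ∀ k l, ∃ C : ℝ, ∀ x, |A x k l| ≤ C
  lift_smooth : ∀ k l, ContDiff ℝ ∞ fun y => B y k l
  lift_periodic : ∀ (y : Fin M → ℝ) (n : Fin M → ℤ), B (fun j => y j + 2 * Real.pi * n j) = B y
  lift_eq : ∀ x, A x = B (Λ *ᵥ x)
  irrational_slope : ∀ p : Fin M → ℤ, p ≠ 0 → Λᵀ *ᵥ (fun j => (p j : ℝ)) ≠ 0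
  symmetric : ∀ x, (A x).IsSymm
  coercive : ∃ α : ℝ, 0 < α ∧ ∀ v : Fin d → ℝ, ∀ᵐ x, α * (v ⬝ᵥ v) ≤ (A x *ᵥ v) ⬝ᵥ v

/-- The complex space `L²(Q)`. -/
abbrev L2 (M : ℕ) := Lp ℂ 2 (volume.restrict (cell M))

/-- The conjugate exponential `y ↦ exp(-i n·y)`, for `n ∈ ℤ^M`. -/
def expNeg {M : ℕ} (n : Fin M → ℤ) (y : Fin M → ℝ) : ℂ :=
  Complex.exp (-Complex.I * ∑ j, (n j : ℂ) * (y j : ℂ))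

/-- The (unnormalised) Fourier coefficient `∫_Q f(y) exp(-i n·y) dy`. -/
def fourierInt {M : ℕ} (f : L2 M) (n : Fin M → ℤ) : ℂ :=
  ∫ y in cell M, f y * expNeg n y

lemma volume_cell_lt_top (M : ℕ) : volume (cell M) < ⊤ := by
  unfold cell
  rw [Real.volume_pi_Ico]
  exact ENNReal.prod_lt_top fun _ _ => ENNReal.ofReal_lt_top

lemma integrable_mul_expNeg {M : ℕ} (f : L2 M) (n : Fin M → ℤ) :
    Integrable (fun y => f y * expNeg n y) (volume.restrict (cell M)) := by
  have : IsFiniteMeasure (volume.restrict (cell M)) := ⟨by simpa using volume_cell_lt_top M⟩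
  have hf : Integrable (f : (Fin M → ℝ) → ℂ) (volume.restrict (cell M)) :=
    (Lp.memLp f).integrable (by norm_num)
  refine hf.mul_bdd (c := 1) ?_ ?_
  · exact (by unfold expNeg; fun_prop : Continuous (expNeg n)).aestronglyMeasurable
  · refine Eventually.of_forall fun y => ?_
    simp [expNeg, Complex.norm_exp, ← Complex.ofReal_intCast, ← Complex.ofReal_mul,
      ← Complex.ofReal_sum]

lemma fourierInt_add {M : ℕ} (f g : L2 M) (n : Fin M → ℤ) :
    fourierInt (f + g) n = fourierInt f n + fourierInt g n := by
  unfold fourierInt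
  rw [← integral_add (integrable_mul_expNeg f n) (integrable_mul_expNeg g n)]
  refine integral_congr_ae ?_
  filter_upwards [Lp.coeFn_add f g] with y hy
  rw [hy, Pi.add_apply, add_mul]

lemma fourierInt_smul {M : ℕ} (c : ℂ) (f : L2 M) (n : Fin M → ℤ) :
    fourierInt (c • f) n = c * fourierInt f n := by
  unfold fourierInt
  rw [← integral_const_mul]
  refine integral_congr_ae ?_
  filter_upwards [Lp.coeFn_smul c f] with y hy
  rw [hy, Pi.smul_apply, smul_eq_mul, mul_assoc]

lemma fourierInt_zero {M : ℕ} (n : Fin M → ℤ) : fourierInt (0 : L2 M) n = 0 := by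
  simpa using fourierInt_smul 0 (0 : L2 M) n

/-- The periodic Sobolev space `H¹_♯(Q)` of complex functions, with the norm
`(‖u‖² + ∑ j, ‖∂_j u‖²)^(1/2)`. An element is stored as a pair `(u, ∇u)`, `u ∈ L²(Q)`,
`∇u ∈ L²(Q)^M`, where the periodic distributional derivative `∂_j u` is the function whose `n`-th
Fourier coefficient is `i n_j` times that of `u`, for all `n ∈ ℤ^M`. Thus `u` occurs exactly when
`∑ n, (1 + |n|²) |û(n)|² < ∞`, and `u` determines `∇u`. -/
def H1 (M : ℕ) : Submodule ℂ (WithLp 2 (L2 M × PiLp 2 fun _ : Fin M => L2 M)) where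
  carrier := {p | ∀ (j : Fin M) (n : Fin M → ℤ),
    fourierInt (p.snd j) n = Complex.I * (n j : ℂ) * fourierInt p.fst n}
  add_mem' := by
    intro p q hp hq j n
    have h := hp j n
    have h' := hq j n
    simp only [WithLp.add_fst, WithLp.add_snd, PiLp.add_apply, fourierInt_add, h, h', mul_add]
  zero_mem' := by
    intro j n
    simp [fourierInt_zero]
  smul_mem' := by
    intro c p hp j n
    have h := hp j n
    simp only [WithLp.smul_fst, WithLp.smul_snd, PiLp.smul_apply, fourierInt_smul, h]
    ring

/-- The values of `u ∈ H¹_♯(Q)` (defined almost everywhere on `Q`). -/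
def val {M : ℕ} (u : H1 M) : (Fin M → ℝ) → ℂ := (u.1.fst : L2 M)

/-- The partial derivative `∂u/∂y_j`. -/
def dy {M : ℕ} (j : Fin M) (u : H1 M) : (Fin M → ℝ) → ℂ := (u.1.snd j : L2 M)

/-- The `k`-th component of `D u = Λᵀ ∇_y u`. -/
def dLam {d M : ℕ} (Λ : Matrix (Fin M) (Fin d) ℝ) (u : H1 M) (k : Fin d) (y : Fin M → ℝ) : ℂ :=
  ∑ j, (Λ j k : ℂ) * dy j u y

/-- The `k`-th component of `(D + iη) u`. -/
def dShift {d M : ℕ} (Λ : Matrix (Fin M) (Fin d) ℝ) (η : Fin d → ℝ) (u : H1 M) (k : Fin d)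
    (y : Fin M → ℝ) : ℂ :=
  dLam Λ u k y + Complex.I * (η k : ℂ) * val u y

/-- The form of `C^δ(η) = -(D+iη)·B(D+iη) - δΔ` on `H¹_♯(Q)`:
`a^δ[η](u,v) = ∫_Q B(D+iη)u · conj((D+iη)v) dy + δ ∫_Q ∇u · conj(∇v) dy`. -/
def blochForm {d M : ℕ} (B : (Fin M → ℝ) → Matrix (Fin d) (Fin d) ℝ)
    (Λ : Matrix (Fin M) (Fin d) ℝ) (δ : ℝ) (η : Fin d → ℝ) (u v : H1 M) : ℂ :=
  (∫ y in cell M, ∑ k, ∑ l, (B y k l : ℂ) * dShift Λ η u l y * conj (dShift Λ η v k y)) +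
    (δ : ℂ) * ∫ y in cell M, ∑ j, dy j u y * conj (dy j v y)

/-- `φ` is an eigenfunction of `C^δ(η)` for the eigenvalue `μ` (in the sense of forms; the
eigenvalues are real because the form is Hermitian). -/
def IsBlochEigenfunction {d M : ℕ} (B : (Fin M → ℝ) → Matrix (Fin d) (Fin d) ℝ)
    (Λ : Matrix (Fin M) (Fin d) ℝ) (δ : ℝ) (η : Fin d → ℝ) (μ : ℝ) (φ : H1 M) : Prop :=
  φ ≠ 0 ∧ ∀ v : H1 M, blochForm B Λ δ η φ v = (μ : ℂ) * ∫ y in cell M, val φ y * conj (val v y)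

/-- The set of regularized Bloch eigenvalues at quasimomentum `η`. -/
def blochEigenvalues {d M : ℕ} (B : (Fin M → ℝ) → Matrix (Fin d) (Fin d) ℝ)
    (Λ : Matrix (Fin M) (Fin d) ℝ) (δ : ℝ) (η : Fin d → ℝ) : Set ℝ :=
  {μ | ∃ φ : H1 M, IsBlochEigenfunction B Λ δ η μ φ}

/-- The first (smallest) regularized Bloch eigenvalue `λ₁^δ(η)`. -/
def blochEigenvalue₁ {d M : ℕ} (B : (Fin M → ℝ) → Matrix (Fin d) (Fin d) ℝ)
    (Λ : Matrix (Fin M) (Fin d) ℝ) (δ : ℝ) (η : Fin d → ℝ) : ℝ :=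
  sInf (blochEigenvalues B Λ δ η)

/-- `ψ ∈ H¹_♯(Q)` solves the regularized cell problem
`-D·B Dψ - δΔψ = D·B e_l`, in the weak sense. -/
def IsCellSolution {d M : ℕ} (B : (Fin M → ℝ) → Matrix (Fin d) (Fin d) ℝ)
    (Λ : Matrix (Fin M) (Fin d) ℝ) (δ : ℝ) (l : Fin d) (ψ : H1 M) : Prop :=
  ∀ v : H1 M,
    (∫ y in cell M, ∑ k, ∑ m, (B y k m : ℂ) * dLam Λ ψ m y * conj (dLam Λ v k y)) +
        (δ : ℂ) * ∫ y in cell M, ∑ j, dy j ψ y * conj (dy j v y) =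
      -∫ y in cell M, ∑ k, (B y k l : ℂ) * conj (dLam Λ v k y)

/-- The entry `q^{δ,*}_{kl} = M_Q(b_{kl} + e_k · B Dψ_l)` of the approximate homogenized matrix,
computed from a solution `ψ_l` of the `l`-th regularized cell problem; `M_Q` is the mean over
`Q`. -/
def approxHom {d M : ℕ} (B : (Fin M → ℝ) → Matrix (Fin d) (Fin d) ℝ)
    (Λ : Matrix (Fin M) (Fin d) ℝ) (k l : Fin d) (ψl : H1 M) : ℂ :=
  ⨍ y in cell M, ((B y k l : ℂ) + ∑ m, (B y k m : ℂ) * dLam Λ ψl m y)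

/-- The partial derivative `∂f/∂η_l` of a function of `η ∈ ℝ^d`. -/
def pderiv {d : ℕ} {E : Type*} [NormedAddCommGroup E] [NormedSpace ℝ E] (l : Fin d)
    (f : (Fin d → ℝ) → E) (η : Fin d → ℝ) : E :=
  fderiv ℝ f η (Pi.single l 1)

end QPBloch

end

open QPBloch

noncomputable section

namespace QPBloch

/-! The statement is analytic perturbation theory for a simple lowest eigenvalue, followed by
testing the eigenvalue equation with constants. On `H¹_♯(Q)` the form is represented by a bounded
symmetric operator T(η), polynomial in η, and with J the inclusion into `L²(Q)` the eigenvalue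
equation reads T(η)φ = λ J*Jφ. Since B ≥ 0, the form dominates δ‖∇u‖². At η = 0 the constant e = 1
is annihilated, and by the Poincaré–Wirtinger inequality (`poincare`, from Parseval) the kernel is
exactly the constants.

Kronecker's theorem (`mem_of_irrational_slope`) carries symmetry and nonnegativity from A to B: the
range of Λ is dense modulo 2πℤ^M and B is continuous. Coercivity of B is not needed, because the
regularization controls the gradient.

For the perturbation step (`exists_analytic_ground_state`), put n = J*Je and V = ‖Je‖². The bordered
operator S(η,s) = T(η) - sJ*J + ⟨n,·⟩n is invertible near (0,0), and ⟨n, S⁻¹n⟩ = 1 forces s to be an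
eigenvalue with eigenvector S⁻¹n. The analytic implicit function theorem solves this scalar equation
for s(η). No smaller eigenvalue exists: its eigenvector would be `L²`-orthogonal to a function close
to 1, and Poincaré would push the eigenvalue above δ/2. No compact embedding enters.

Testing the eigenvalue equation with e, where De = 0, gives V s(η) = ∑ η_k F_k(η), with F_k the real
part of a flux that vanishes at 0 (`eigenvalue_mul_eq_sum_meanFlux`). Hence the gradient of s
vanishes at 0 and its Hessian needs only first derivatives of F_k (`pderiv_of_eq_sum_mul`).
Differentiating the eigenvalue equation once shows that ∂_lφ - iφ(0)ψ_l lies in the kernel of T(0),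
so it is constant. This also produces a cell solution and turns ∂_lF_k into V q_{kl}. Symmetry and
reality of q, proved with real cell solutions, finish the Hessian formula. -/

lemma inner_self_eq_ofReal {E : Type*} [NormedAddCommGroup E] [InnerProductSpace ℂ E] (v : E) :
    inner ℂ v v = ((‖v‖ ^ 2 : ℝ) : ℂ) := by
  rw [inner_self_eq_norm_sq_to_K]
  norm_cast

/-! ### Perturbation of a simple lowest eigenvalue in Hilbert space -/

section GroundState

open ContinuousLinearMap

variable {X H L : Type*} [NormedAddCommGroup X] [NormedSpace ℝ X] [CompleteSpace X]
  [NormedAddCommGroup H] [InnerProductSpace ℂ H] [CompleteSpace H]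
  [NormedAddCommGroup L] [InnerProductSpace ℂ L] [CompleteSpace L]

/-- The bordered operator `T - s J*J + ⟨J*J e, ·⟩ J*J e`. -/
def bordered (T : H →L[ℂ] H) (J : H →L[ℂ] L) (e : H) (s : ℝ) : H →L[ℂ] H :=
  T - (s : ℂ) • (adjoint J ∘L J) +
    (innerSL ℂ ((adjoint J ∘L J) e)).smulRight ((adjoint J ∘L J) e)

lemma bordered_apply (T : H →L[ℂ] H) (J : H →L[ℂ] L) (e u : H) (s : ℝ) :
    bordered T J e s u = T u - (s : ℂ) • adjoint J (J u) +
      inner ℂ (J e) (J u) • adjoint J (J e) := by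
  simp [bordered, adjoint_inner_left]

lemma inner_bordered_symm {T : H →L[ℂ] H} (hT : ∀ u v, inner ℂ (T u) v = inner ℂ u (T v))
    (J : H →L[ℂ] L) (e : H) (s : ℝ) (u v : H) :
    inner ℂ (bordered T J e s u) v = inner ℂ u (bordered T J e s v) := by
  simp only [bordered_apply, inner_add_left, inner_sub_left, inner_add_right, inner_sub_right,
    inner_smul_left, inner_smul_right, adjoint_inner_left, adjoint_inner_right, hT,
    Complex.conj_ofReal, inner_conj_symm]
  ring

/-- A Lax–Milgram argument. In the application ‖u‖² - ‖Ju‖² is ‖∇u‖², which `hlow` controls; the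
rank-one term controls the mean, and the Poincaré inequality `hP` combines the two into coercivity
on all of H. -/
lemma isUnit_bordered_zero {T : H →L[ℂ] H} {J : H →L[ℂ] L} {e : H} {δ : ℝ} (hδ : 0 < δ)
    (hJ : ∀ u, ‖J u‖ ≤ ‖u‖)
    (hlow : ∀ u, δ * (‖u‖ ^ 2 - ‖J u‖ ^ 2) ≤ (inner ℂ u (T u)).re)
    (hP : ∀ u, ‖J e‖ ^ 2 * ‖J u‖ ^ 2 ≤
      ‖J e‖ ^ 2 * (‖u‖ ^ 2 - ‖J u‖ ^ 2) + ‖inner ℂ (J e) (J u)‖ ^ 2)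
    (hJe : J e ≠ 0) : IsUnit (bordered T J e 0) := by
  have hV : 0 < ‖J e‖ ^ 2 := by positivity
  set V := ‖J e‖ ^ 2 with hVdef
  -- Below, ‖u‖² ≤ 2a + b/V while the form is at least δa + b, so c must satisfy 2c ≤ δ and c ≤ V.
  set c : ℝ := min (δ / 2) V with hc
  have hc0 : 0 < c := lt_min (by linarith) hV
  refine isUnit_of_forall_le_norm_inner_map (𝕜 := ℂ) _ (c := ⟨c, hc0.le⟩) hc0 fun u => ?_
  rw [norm_inner_symm]
  refine le_trans ?_ (Complex.re_le_norm _)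
  have h1 : (inner ℂ u (bordered T J e 0 u)).re =
      (inner ℂ u (T u)).re + ‖inner ℂ (J e) (J u)‖ ^ 2 := by
    simp only [bordered_apply, inner_add_right, inner_smul_right, adjoint_inner_right,
      Complex.ofReal_zero, zero_smul, sub_zero, Complex.add_re]
    rw [← inner_conj_symm (J u) (J e), Complex.mul_conj, Complex.ofReal_re,
      Complex.normSq_eq_norm_sq]
  rw [h1]
  have h2 := hlow u
  have h3 := hP u
  have ha : 0 ≤ ‖u‖ ^ 2 - ‖J u‖ ^ 2 := by
    have := hJ u
    have := norm_nonneg (J u)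
    nlinarith
  set a := ‖u‖ ^ 2 - ‖J u‖ ^ 2 with hadef
  set b := ‖inner ℂ (J e) (J u)‖ ^ 2 with hb
  have hb0 : 0 ≤ b := by positivity
  have h4 : V * ‖u‖ ^ 2 ≤ 2 * V * a + b := by nlinarith
  have h5 : ‖u‖ ^ 2 ≤ 2 * a + b / V := by
    rw [← sub_nonneg] at h4 ⊢
    have : 2 * a + b / V - ‖u‖ ^ 2 = (2 * V * a + b - V * ‖u‖ ^ 2) / V := by
      field_simp
    rw [this]; positivity
  calc ‖u‖ ^ 2 * c ≤ (2 * a + b / V) * c := by gcongr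
    _ = 2 * a * c + b / V * c := by ring
    _ ≤ 2 * a * (δ / 2) + b / V * V := by
        gcongr
        · exact min_le_left _ _
        · exact min_le_right _ _
    _ = δ * a + b := by field_simp
    _ ≤ _ := by gcongr

/-- Eigenvectors for different eigenvalues have orthogonal images under J. As Jφ is close to Je, an
eigenvector u for μ < s has a small component along Je, so `hP` gives ‖Ju‖² ≤ 2(‖u‖² - ‖Ju‖²). Then
`hlow` forces μ ≥ δ/2 > s, a contradiction. -/
lemma le_of_eigen {T : H →L[ℂ] H} {J : H →L[ℂ] L} {e : H} {δ : ℝ} (hδ : 0 < δ)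
    (hT : ∀ u v, inner ℂ (T u) v = inner ℂ u (T v))
    (hlow : ∀ u, δ * (‖u‖ ^ 2 - ‖J u‖ ^ 2) ≤ (inner ℂ u (T u)).re)
    (hP : ∀ u, ‖J e‖ ^ 2 * ‖J u‖ ^ 2 ≤
      ‖J e‖ ^ 2 * (‖u‖ ^ 2 - ‖J u‖ ^ 2) + ‖inner ℂ (J e) (J u)‖ ^ 2)
    (hJe : J e ≠ 0) {φ : H} {s : ℝ} (hφ : T φ = (s : ℂ) • adjoint J (J φ)) (hs : s < δ / 2)
    (hφe : ‖J φ - J e‖ ^ 2 ≤ ‖J e‖ ^ 2 / 2) {μ : ℝ} {u : H} (hu : u ≠ 0)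
    (huμ : T u = (μ : ℂ) • adjoint J (J u)) : s ≤ μ := by
  by_contra! hlt
  have hV : 0 < ‖J e‖ ^ 2 := by positivity
  have horth : inner ℂ (J φ) (J u) = 0 := by
    have h := hT φ u
    rw [hφ, huμ] at h
    simp only [inner_smul_left, inner_smul_right, adjoint_inner_left, adjoint_inner_right,
      Complex.conj_ofReal] at h
    have h' : ((s : ℂ) - μ) * inner ℂ (J φ) (J u) = 0 := by rw [sub_mul, h, sub_self]
    refine (mul_eq_zero.1 h').resolve_left ?_
    exact sub_ne_zero.2 (by exact_mod_cast hlt.ne')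
  have h1 : ‖inner ℂ (J e) (J u)‖ ^ 2 ≤ ‖J e‖ ^ 2 / 2 * ‖J u‖ ^ 2 := by
    have : inner ℂ (J e) (J u) = -inner ℂ (J φ - J e) (J u) := by
      rw [inner_sub_left, horth]; ring
    rw [this, norm_neg]
    calc ‖inner ℂ (J φ - J e) (J u)‖ ^ 2 ≤ (‖J φ - J e‖ * ‖J u‖) ^ 2 := by
          gcongr; exact norm_inner_le_norm _ _
      _ = ‖J φ - J e‖ ^ 2 * ‖J u‖ ^ 2 := by ring
      _ ≤ _ := by gcongr
  have h2 : ‖J u‖ ^ 2 ≤ 2 * (‖u‖ ^ 2 - ‖J u‖ ^ 2) := by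
    have := hP u
    by_contra! hcon
    nlinarith
  have h3 : (inner ℂ u (T u)).re = μ * ‖J u‖ ^ 2 := by
    rw [huμ, inner_smul_right, adjoint_inner_right, inner_self_eq_ofReal, ← Complex.ofReal_mul,
      Complex.ofReal_re]
  have h4 := hlow u
  rw [h3] at h4
  -- If Ju = 0, the lower bound alone forces u = 0.
  by_cases hJu : ‖J u‖ = 0
  · rw [hJu] at h4
    have : 0 < ‖u‖ := norm_pos_iff.2 hu
    have : 0 < δ * ‖u‖ ^ 2 := by positivity
    norm_num at h4
    linarith
  · have : 0 < ‖J u‖ ^ 2 := by positivity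
    nlinarith

/-- A simple isolated lowest eigenvalue of an analytic family of symmetric operators stays the
lowest eigenvalue and is analytic, together with an eigenvector. -/
theorem exists_analytic_ground_state {T : X → H →L[ℂ] H} {J : H →L[ℂ] L} {e : H} {δ : ℝ}
    (hδ : 0 < δ) (hTa : AnalyticAt ℝ T 0)
    (hT : ∀ x u v, inner ℂ (T x u) v = inner ℂ u (T x v))
    (hJ : ∀ u, ‖J u‖ ≤ ‖u‖)
    (hlow : ∀ x u, δ * (‖u‖ ^ 2 - ‖J u‖ ^ 2) ≤ (inner ℂ u (T x u)).re)
    (hP : ∀ u, ‖J e‖ ^ 2 * ‖J u‖ ^ 2 ≤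
      ‖J e‖ ^ 2 * (‖u‖ ^ 2 - ‖J u‖ ^ 2) + ‖inner ℂ (J e) (J u)‖ ^ 2)
    (he : T 0 e = 0) (hJe : J e ≠ 0) :
    ∃ (s : X → ℝ) (φ : X → H), AnalyticAt ℝ s 0 ∧ AnalyticAt ℝ φ 0 ∧ s 0 = 0 ∧ φ 0 = e ∧
      ∀ᶠ x in 𝓝 0, φ x ≠ 0 ∧ inner ℂ (J e) (J (φ x)) = ((‖J e‖ ^ 2 : ℝ) : ℂ) ∧
        T x (φ x) = (s x : ℂ) • adjoint J (J (φ x)) ∧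
        ∀ (μ : ℝ) (u : H), u ≠ 0 → T x u = (μ : ℂ) • adjoint J (J u) → s x ≤ μ := by
  have hV : 0 < ‖J e‖ ^ 2 := by positivity
  set V := ‖J e‖ ^ 2 with hVdef
  set S : X × ℝ → H →L[ℂ] H := fun p => bordered (T p.1) J e p.2 with hS
  have hSa : AnalyticAt ℝ S 0 := by
    have h1 : AnalyticAt ℝ (fun p : X × ℝ => T p.1) 0 :=
      AnalyticAt.comp (g := T) (f := Prod.fst) (x := (0 : X × ℝ)) hTa analyticAt_fst
    have h2 : AnalyticAt ℝ (fun p : X × ℝ => p.2 • (adjoint J ∘L J)) 0 :=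
      analyticAt_snd.smul analyticAt_const
    exact (h1.sub h2).add analyticAt_const
  have hU : IsUnit (S 0) := isUnit_bordered_zero hδ hJ (hlow 0) hP hJe
  -- On the slice x = 0 the vector e is explicit, which gives the resolvent there in closed form.
  have hSe : ∀ s : ℝ, S (0, s) e = ((V - s : ℝ) : ℂ) • adjoint J (J e) := by
    intro s
    simp only [hS, bordered_apply, he, inner_self_eq_ofReal]
    rw [zero_sub, ← neg_smul, ← add_smul]
    congr 1
    push_cast [hVdef]
    ring
  set R : X × ℝ → H →L[ℂ] H := fun p => Ring.inverse (S p) with hR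
  have hRa : AnalyticAt ℝ R 0 := by
    have h1 : AnalyticAt ℝ (Ring.inverse : (H →L[ℂ] H) → _) (S 0) := by
      obtain ⟨z, hz⟩ := hU
      rw [← hz]
      exact (analyticAt_inverse (𝕜 := ℂ) z).restrictScalars
    exact AnalyticAt.comp (g := Ring.inverse) (f := S) h1 hSa
  have hSunit : ∀ᶠ p in 𝓝 (0 : X × ℝ), IsUnit (S p) :=
    hSa.continuousAt.eventually (Units.isOpen.mem_nhds hU)
  have hRS : ∀ p, IsUnit (S p) → ∀ u, R p (S p u) = u := fun p hp u => by
    have := Ring.inverse_mul_cancel _ hp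
    exact DFunLike.congr_fun this u
  have hSR : ∀ p, IsUnit (S p) → ∀ u, S p (R p u) = u := fun p hp u => by
    have := Ring.mul_inverse_cancel _ hp
    exact DFunLike.congr_fun this u
  set n : H := adjoint J (J e) with hn
  set evn : (H →L[ℂ] H) →L[ℝ] H := (ContinuousLinearMap.apply ℂ H n).restrictScalars ℝ with hevn
  -- If ⟨n, R p n⟩ = 1, the rank-one term of S p maps R p n to n itself, so the remaining part T -
  -- sJ*J annihilates R p n. The equation g = 1 therefore selects the eigenvalue.
  set g : X × ℝ → ℝ := fun p => (inner ℂ n (R p n)).re with hg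
  have hRn : AnalyticAt ℝ (fun p => R p n) 0 := (evn.analyticAt _).comp hRa
  have hga : AnalyticAt ℝ g 0 :=
    ((Complex.reCLM.comp ((innerSL ℂ n).restrictScalars ℝ)).analyticAt _).comp hRn
  have hne : inner ℂ n e = (V : ℂ) := by
    rw [hn, adjoint_inner_left, inner_self_eq_ofReal]
  have hg0s : ∀ᶠ s in 𝓝 (0 : ℝ), g (0, s) = V / (V - s) := by
    have hc : Tendsto (fun s : ℝ => ((0 : X), s)) (𝓝 0) (𝓝 (0 : X × ℝ)) :=
      (Continuous.prodMk_right (0 : X)).tendsto 0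
    filter_upwards [hc.eventually hSunit, Iio_mem_nhds hV] with s hs hsV
    have hne0 : ((V - s : ℝ) : ℂ) ≠ 0 := by
      exact_mod_cast (sub_pos.2 hsV).ne'
    have h1 : R (0, s) n = (((V - s : ℝ) : ℂ))⁻¹ • e := by
      have := hRS _ hs e
      rw [hSe, map_smul] at this
      rw [← this, smul_smul, inv_mul_cancel₀ hne0, one_smul]
    simp only [hg, h1, inner_smul_right, hne]
    rw [← Complex.ofReal_inv, ← Complex.ofReal_mul, Complex.ofReal_re]
    ring
  have hg0 : g 0 = 1 := by
    have := hg0s.self_of_nhds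
    rw [sub_zero, div_self hV.ne'] at this
    exact this
  have hgω : ContDiffAt ℝ ω g 0 := hga.contDiffAt
  have hgd : (fderiv ℝ g 0 ∘L .inr ℝ X ℝ) 1 = 1 / V := by
    have h1 : HasDerivAt (fun s : ℝ => g (0, s)) ((fderiv ℝ g 0) (0, 1)) 0 := by
      have h2 : HasFDerivAt g (fderiv ℝ g 0) ((0 : X), (0 : ℝ)) := hga.differentiableAt.hasFDerivAt
      exact h2.comp_hasDerivAt (0 : ℝ) ((hasDerivAt_const _ _).prodMk (hasDerivAt_id _))
    have h2 : HasDerivAt (fun s : ℝ => V / (V - s)) (1 / V) 0 := by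
      have := (hasDerivAt_const (0 : ℝ) V).div ((hasDerivAt_id (0 : ℝ)).const_sub V)
        (by simpa using hV.ne')
      refine this.congr_deriv ?_
      simp only [id, sub_zero, zero_mul, zero_sub]
      field_simp
    exact h1.unique (h2.congr_of_eventuallyEq hg0s)
  have hinv : (fderiv ℝ g 0 ∘L .inr ℝ X ℝ).IsInvertible := by
    refine ⟨ContinuousLinearEquiv.smulLeft (Units.mk0 (1 / V) (by positivity)), ?_⟩
    ext
    simp only [hgd]
    simp [Units.smul_def]
  -- The implicit function theorem in the class `ω`, so that the solution is analytic.
  set s : X → ℝ := hgω.implicitFunction (by simp) hinv with hs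
  have hs0 : s 0 = 0 := hgω.implicitFunction_apply_self (by simp) hinv
  have hsa : AnalyticAt ℝ s 0 :=
    (hgω.contDiffAt_implicitFunction (by simp) hinv).analyticAt
  have hsg : ∀ᶠ x in 𝓝 (0 : X), g (x, s x) = 1 := by
    rw [← hg0]
    exact hgω.eventually_apply_implicitFunction (by simp) hinv
  have hps : AnalyticAt ℝ (fun x => (x, s x)) (0 : X) := analyticAt_id.prod hsa
  have hps0 : ((0 : X), s 0) = 0 := by rw [hs0]; rfl
  have hpt : Tendsto (fun x => (x, s x)) (𝓝 (0 : X)) (𝓝 0) := by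
    have := hps.continuousAt.tendsto
    rwa [hps0] at this
  have hφa : AnalyticAt ℝ (fun x => V • R (x, s x) n) (0 : X) := by
    have : AnalyticAt ℝ (fun x => R (x, s x) n) (0 : X) :=
      AnalyticAt.comp (g := fun p => R p n) (f := fun x => (x, s x)) (by rwa [hps0]) hps
    exact analyticAt_const.smul this
  have hφ0 : V • R (0, s 0) n = e := by
    have h1 := hRS 0 hU e
    have h2 := hSe 0
    rw [sub_zero] at h2
    rw [hps0]
    change R 0 (S (0, 0) e) = e at h1
    rw [h2, map_smul] at h1
    exact h1
  refine ⟨s, fun x => V • R (x, s x) n, hsa, hφa, hs0, hφ0, ?_⟩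
  have hφc : Tendsto (fun x => ‖J (V • R (x, s x) n) - J e‖ ^ 2) (𝓝 (0 : X)) (𝓝 0) := by
    have h1 : ContinuousAt (fun x => ‖J (V • R (x, s x) n) - J e‖ ^ 2) (0 : X) :=
      ((J.continuous.continuousAt.comp hφa.continuousAt).sub continuousAt_const).norm.pow 2
    have h2 := h1.tendsto
    simp only [hφ0, sub_self, norm_zero] at h2
    simpa using h2
  have hst : Tendsto s (𝓝 0) (𝓝 0) := by
    have := hsa.continuousAt.tendsto
    rwa [hs0] at this
  -- The thresholds V/2 and δ/2 are those required by `le_of_eigen`.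
  filter_upwards [hpt.eventually hSunit, hsg, hφc.eventually (Iic_mem_nhds (half_pos hV)),
    hst.eventually (Iio_mem_nhds (half_pos hδ))] with x hxU hxg hxφ hxs
  have hSx : S (x, s x) (R (x, s x) n) = n := hSR _ hxU n
  -- The equation g = 1 fixes only the real part; symmetry of S makes the inner product real.
  have hreal : inner ℂ n (R (x, s x) n) = 1 := by
    apply Complex.ext
    · exact hxg
    · have h1 : inner ℂ (S (x, s x) (R (x, s x) n)) (R (x, s x) n) =
          inner ℂ (R (x, s x) n) (S (x, s x) (R (x, s x) n)) :=
        inner_bordered_symm (hT x) J e (s x) _ _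
      rw [hSx, ← inner_conj_symm (R (x, s x) n) n] at h1
      simpa using Complex.conj_eq_iff_im.1 h1.symm
  have hJφ : inner ℂ (J e) (J (V • R (x, s x) n)) = (V : ℂ) := by
    rw [← adjoint_inner_left, ← hn, ← Complex.coe_smul, inner_smul_right, hreal, mul_one]
  have heig : T x (V • R (x, s x) n) = (s x : ℂ) • adjoint J (J (V • R (x, s x) n)) := by
    have h1 : S (x, s x) (V • R (x, s x) n) = (V : ℂ) • n := by
      rw [← Complex.coe_smul, map_smul, hSx]
    simp only [hS] at h1
    rw [bordered_apply, hJφ, ← hn, add_eq_right, sub_eq_zero] at h1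
    exact h1
  refine ⟨fun h0 => ?_, hJφ, heig, fun μ u hu huμ =>
    le_of_eigen hδ (hT x) (hlow x) hP hJe heig hxs hxφ hu huμ⟩
  rw [h0, map_zero, inner_zero_right] at hJφ
  exact hV.ne (by exact_mod_cast hJφ)

omit [CompleteSpace H] [CompleteSpace L] in
/-- The null space of the unperturbed operator is spanned by `e`. -/
lemma eq_smul_of_apply_eq_zero {T : H →L[ℂ] H} {J : H →L[ℂ] L} {e : H} {δ : ℝ} (hδ : 0 < δ)
    (hlow : ∀ u, δ * (‖u‖ ^ 2 - ‖J u‖ ^ 2) ≤ (inner ℂ u (T u)).re)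
    (hP : ∀ u, ‖J e‖ ^ 2 * ‖J u‖ ^ 2 ≤
      ‖J e‖ ^ 2 * (‖u‖ ^ 2 - ‖J u‖ ^ 2) + ‖inner ℂ (J e) (J u)‖ ^ 2)
    (he : T e = 0) (hJe : J e ≠ 0) {u : H} (hu : T u = 0) : ∃ c : ℂ, u = c • e := by
  have hV : 0 < ‖J e‖ ^ 2 := by positivity
  set c : ℂ := inner ℂ (J e) (J u) / ((‖J e‖ ^ 2 : ℝ) : ℂ) with hc
  refine ⟨c, ?_⟩
  rw [← sub_eq_zero]
  set w := u - c • e with hw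
  have hTw : T w = 0 := by rw [hw, map_sub, map_smul, he, hu]; simp
  have hw0 : inner ℂ (J e) (J w) = 0 := by
    have : ((‖J e‖ ^ 2 : ℝ) : ℂ) ≠ 0 := by exact_mod_cast hV.ne'
    rw [hw, map_sub, map_smul, inner_sub_right, inner_smul_right, inner_self_eq_ofReal, hc,
      div_mul_cancel₀ _ this, sub_self]
  have h1 := hlow w
  have h2 := hP w
  rw [hTw, inner_zero_right, Complex.zero_re] at h1
  rw [hw0, norm_zero] at h2
  have h3 : ‖w‖ ^ 2 - ‖J w‖ ^ 2 ≤ 0 := by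
    by_contra! h
    nlinarith
  have h4 : ‖J w‖ ^ 2 ≤ ‖w‖ ^ 2 - ‖J w‖ ^ 2 := by
    refine le_of_mul_le_mul_left ?_ hV
    linarith
  have h5 : ‖w‖ ^ 2 ≤ 0 := by nlinarith [sq_nonneg ‖J w‖]
  exact norm_eq_zero.1 (pow_eq_zero_iff (two_ne_zero) |>.1 (le_antisymm h5 (sq_nonneg _)))

end GroundState

/-! ### Operators quadratic in η: first-order perturbation and fluxes -/

section QuadraticFamily

open ContinuousLinearMap

variable {d : ℕ} {H L : Type*}
  [NormedAddCommGroup H] [InnerProductSpace ℂ H] [CompleteSpace H]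
  [NormedAddCommGroup L] [InnerProductSpace ℂ L] [CompleteSpace L]
  (D : Fin d → H →L[ℂ] L) (m : Fin d → Fin d → L →L[ℂ] L) (J : H →L[ℂ] L) (S : H →L[ℂ] H)

/-- The operator that represents the form
`∑ k l, ⟪(D_k + i η_k J) v, m_{kl} (D_l + i η_l J) u⟫ + ⟪v, S u⟫`, as a polynomial in `η`. -/
def formOp (η : Fin d → ℝ) : H →L[ℂ] H :=
  (∑ k, ∑ l, (adjoint (D k) ∘L m k l ∘L D l +
    η l • (Complex.I • (adjoint (D k) ∘L m k l ∘L J)) -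
    η k • (Complex.I • (adjoint J ∘L m k l ∘L D l)) +
    (η k * η l) • (adjoint J ∘L m k l ∘L J))) + S

lemma inner_formOp (η : Fin d → ℝ) (u v : H) :
    inner ℂ v (formOp D m J S η u) =
      ∑ k, ∑ l, inner ℂ (D k v + (Complex.I * (η k : ℂ)) • J v)
        (m k l (D l u + (Complex.I * (η l : ℂ)) • J u)) + inner ℂ v (S u) := by
  simp only [formOp, add_apply, sum_apply, inner_add_right, inner_sum,
    smul_apply, inner_smul_right, comp_apply, adjoint_inner_right,
    map_add, map_smul, inner_add_left, inner_smul_left, sub_apply, inner_sub_right,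
    ← Complex.coe_smul, map_mul, Complex.conj_I, Complex.conj_ofReal]
  congr 1
  refine Finset.sum_congr rfl fun k _ => Finset.sum_congr rfl fun l _ => ?_
  push_cast
  linear_combination ((η k * η l : ℂ) * inner ℂ (J v) (m k l (J u))) * Complex.I_sq

lemma analyticAt_formOp (η₀ : Fin d → ℝ) : AnalyticAt ℝ (formOp D m J S) η₀ := by
  have h : ∀ k, AnalyticAt ℝ (fun η : Fin d → ℝ => η k) η₀ := fun k =>
    (ContinuousLinearMap.proj (R := ℝ) (φ := fun _ : Fin d => ℝ) k).analyticAt η₀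
  unfold formOp
  refine AnalyticAt.add ?_ analyticAt_const
  refine Finset.analyticAt_fun_sum _ fun k _ => Finset.analyticAt_fun_sum _ fun l _ => ?_
  exact ((analyticAt_const.add ((h l).smul analyticAt_const)).sub
    ((h k).smul analyticAt_const)).add (((h k).mul (h l)).smul analyticAt_const)

/-- The derivative of `formOp` at `0` in the direction `e_l`. -/
def formOpDeriv (l : Fin d) : H →L[ℂ] H :=
  ∑ k, Complex.I • (adjoint (D k) ∘L m k l ∘L J) -
    ∑ k, Complex.I • (adjoint J ∘L m l k ∘L D k)

/-- Computed along the line t ↦ t e_l, where the terms quadratic in η contribute nothing at t = 0.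
-/
lemma fderiv_formOp_single (l : Fin d) :
    fderiv ℝ (formOp D m J S) 0 (Pi.single l 1) = formOpDeriv D m J l := by
  have h : ∀ k, HasDerivAt (fun t : ℝ => (t • Pi.single l 1 : Fin d → ℝ) k)
      ((Pi.single l 1 : Fin d → ℝ) k) 0 := fun k => by
    simpa using (hasDerivAt_id (0 : ℝ)).mul_const ((Pi.single l 1 : Fin d → ℝ) k)
  have h2 : HasDerivAt (fun t : ℝ => formOp D m J S (t • Pi.single l 1))
      (∑ k, ∑ n, ((Pi.single l 1 : Fin d → ℝ) n • (Complex.I • (adjoint (D k) ∘L m k n ∘L J)) -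
        (Pi.single l 1 : Fin d → ℝ) k • (Complex.I • (adjoint J ∘L m k n ∘L D n)))) 0 := by
    unfold formOp
    refine HasDerivAt.add_const _ ?_
    refine HasDerivAt.fun_sum fun k _ => HasDerivAt.fun_sum fun n _ => ?_
    have h3 := (((h n).smul_const (Complex.I • (adjoint (D k) ∘L m k n ∘L J))).const_add
      (adjoint (D k) ∘L m k n ∘L D n)).sub
      ((h k).smul_const (Complex.I • (adjoint J ∘L m k n ∘L D n)))
    refine (h3.add (((h k).mul (h n)).smul_const _)).congr_deriv ?_
    simp
  have h3 : HasDerivAt (fun t : ℝ => formOp D m J S (t • Pi.single l 1))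
      (fderiv ℝ (formOp D m J S) 0 (Pi.single l 1)) 0 := by
    have h4 : HasFDerivAt (formOp D m J S) (fderiv ℝ (formOp D m J S) 0)
        ((0 : ℝ) • Pi.single l 1 : Fin d → ℝ) := by
      rw [zero_smul]
      exact (analyticAt_formOp D m J S 0).differentiableAt.hasFDerivAt
    have h5 := (hasDerivAt_id (0 : ℝ)).smul_const (Pi.single l 1 : Fin d → ℝ)
    rw [one_smul] at h5
    exact h4.comp_hasDerivAt (0 : ℝ) h5
  rw [h3.unique h2]
  simp only [Finset.sum_sub_distrib, formOpDeriv]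
  congr 1
  · refine Finset.sum_congr rfl fun k _ => ?_
    rw [Finset.sum_eq_single l (fun n _ hn => by simp [hn]) (by simp)]
    simp
  · rw [Finset.sum_eq_single l (fun n _ hn => by simp [hn]) (by simp)]
    simp

variable {D m J S}

/-- The right-hand side `∑ k, D_k* m_{kl} J e` of the cell problem, up to sign. -/
def cellSource (D : Fin d → H →L[ℂ] L) (m : Fin d → Fin d → L →L[ℂ] L) (J : H →L[ℂ] L) (e : H)
    (l : Fin d) : H :=
  ∑ k, adjoint (D k) (m k l (J e))

lemma formOpDeriv_apply {e : H} (hD : ∀ k, D k e = 0) (l : Fin d) :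
    formOpDeriv D m J l e = Complex.I • cellSource D m J e l := by
  simp [formOpDeriv, cellSource, hD, Finset.smul_sum]

/-- Differentiating the eigenvalue equation at a critical point. -/
lemma formOp_fderiv_eigenvector {e : H} (hD : ∀ k, D k e = 0) {s : (Fin d → ℝ) → ℝ}
    {φ : (Fin d → ℝ) → H} (hs : DifferentiableAt ℝ s 0) (hs0 : s 0 = 0) {l : Fin d}
    (hsl : fderiv ℝ s 0 (Pi.single l 1) = 0) (hφ : DifferentiableAt ℝ φ 0) {c : ℂ}
    (hφ0 : φ 0 = c • e)
    (heq : ∀ᶠ η in 𝓝 0, formOp D m J S η (φ η) = (s η : ℂ) • adjoint J (J (φ η))) :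
    formOp D m J S 0 (fderiv ℝ φ 0 (Pi.single l 1)) = -(Complex.I * c) • cellSource D m J e l := by
  set p : Fin d → ℝ := Pi.single l 1 with hp
  have hline : HasDerivAt (fun t : ℝ => t • p) p 0 := by
    simpa using (hasDerivAt_id (0 : ℝ)).smul_const p
  have hT : HasDerivAt (fun t : ℝ => formOp D m J S (t • p)) (formOpDeriv D m J l) 0 := by
    rw [← fderiv_formOp_single D m J S]
    have h0 : HasFDerivAt (formOp D m J S) (fderiv ℝ (formOp D m J S) 0) ((0 : ℝ) • p) := by
      rw [zero_smul]
      exact (analyticAt_formOp D m J S 0).differentiableAt.hasFDerivAt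
    exact h0.comp_hasDerivAt (0 : ℝ) hline
  have hφ' : HasDerivAt (fun t : ℝ => φ (t • p)) (fderiv ℝ φ 0 p) 0 := by
    have h0 : HasFDerivAt φ (fderiv ℝ φ 0) ((0 : ℝ) • p) := by
      rw [zero_smul]
      exact hφ.hasFDerivAt
    exact h0.comp_hasDerivAt (0 : ℝ) hline
  have hs' : HasDerivAt (fun t : ℝ => s (t • p)) 0 0 := by
    have h2 : HasDerivAt (fun t : ℝ => s (t • p)) (fderiv ℝ s 0 p) 0 := by
      refine HasFDerivAt.comp_hasDerivAt (0 : ℝ) (f := fun t : ℝ => t • p) ?_ hline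
      rw [zero_smul]
      exact hs.hasFDerivAt
    rwa [hsl] at h2
  have h1 : HasDerivAt (fun t : ℝ => formOp D m J S (t • p) (φ (t • p)))
      (formOpDeriv D m J l (φ 0) + formOp D m J S 0 (fderiv ℝ φ 0 p)) 0 := by
    -- The operators are complex linear but the parameter is real, so scalars are restricted before
    -- the product rule for evaluation.
    have h2 := (((ContinuousLinearMap.restrictScalarsL ℂ H H ℝ ℝ).hasFDerivAt.comp_hasDerivAt
      (0 : ℝ) hT).clm_apply hφ')
    simp only [Function.comp_apply, zero_smul] at h2
    exact h2
  -- The right-hand side has zero derivative because both s and its derivative in this direction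
  -- vanish at 0.
  have hN : HasDerivAt (fun t : ℝ => s (t • p) • adjoint J (J (φ (t • p)))) 0 0 := by
    have h2 : HasDerivAt (fun t : ℝ => adjoint J (J (φ (t • p))))
        (adjoint J (J (fderiv ℝ φ 0 p))) 0 :=
      ((adjoint J ∘L J).restrictScalars ℝ).hasFDerivAt.comp_hasDerivAt (0 : ℝ) hφ'
    have h3 := hs'.smul h2
    rwa [zero_smul, hs0, zero_smul, zero_smul, add_zero] at h3
  have ht : Tendsto (fun t : ℝ => t • p) (𝓝 0) (𝓝 0) := by
    have := hline.continuousAt.tendsto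
    rwa [zero_smul] at this
  have h4 := h1.unique (hN.congr_of_eventuallyEq ((ht.eventually heq).mono fun t h => by
    simp only [h, Complex.coe_smul]))
  rw [hφ0, map_smul, formOpDeriv_apply hD, add_comm, add_eq_zero_iff_eq_neg] at h4
  rw [h4, smul_smul, neg_smul, mul_comm]

/-- The `k`-th flux `-i ∑ l, ⟪J e, m_{kl} (D_l + i η_l J) u⟫`. -/
def meanFlux (D : Fin d → H →L[ℂ] L) (m : Fin d → Fin d → L →L[ℂ] L) (J : H →L[ℂ] L) (e : H)
    (k : Fin d) (η : Fin d → ℝ) (u : H) : ℂ :=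
  -Complex.I * ∑ l, inner ℂ (J e) (m k l (D l u + (Complex.I * (η l : ℂ)) • J u))

/-- The eigenvalue equation tested with e: since D_k e = 0, only the terms iη_k Je survive on the
test side, which extracts a factor η_k. The normalization of u makes the left side exactly s‖Je‖².
-/
lemma eigenvalue_mul_eq_sum_meanFlux {e : H} (hD : ∀ k, D k e = 0)
    (hS : ∀ u, inner ℂ e (S u) = 0) {η : Fin d → ℝ} {s : ℝ} {u : H}
    (hu : inner ℂ (J e) (J u) = ((‖J e‖ ^ 2 : ℝ) : ℂ))
    (heq : formOp D m J S η u = (s : ℂ) • adjoint J (J u)) :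
    s * ‖J e‖ ^ 2 = ∑ k, η k * (meanFlux D m J e k η u).re := by
  have h := inner_formOp D m J S η u e
  rw [heq, inner_smul_right, adjoint_inner_right, hu, hS, add_zero, ← Complex.ofReal_mul] at h
  have h2 := congrArg Complex.re h
  rw [Complex.ofReal_re] at h2
  rw [h2, Complex.re_sum]
  refine Finset.sum_congr rfl fun k _ => ?_
  rw [← Complex.re_ofReal_mul]
  congr 1
  simp only [hD, zero_add, inner_smul_left, meanFlux, map_mul, Complex.conj_I, Complex.conj_ofReal,
    ← Finset.mul_sum]
  ring

omit [CompleteSpace H] [CompleteSpace L] in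
lemma analyticAt_meanFlux (e : H) (k : Fin d) {φ : (Fin d → ℝ) → H} (hφ : AnalyticAt ℝ φ 0) :
    AnalyticAt ℝ (fun η => meanFlux D m J e k η (φ η)) 0 := by
  unfold meanFlux
  refine analyticAt_const.mul (Finset.analyticAt_fun_sum _ fun l _ => ?_)
  have h1 : AnalyticAt ℝ (fun η : Fin d → ℝ => Complex.I * (η l : ℂ)) 0 :=
    analyticAt_const.mul ((Complex.ofRealCLM ∘L
      ContinuousLinearMap.proj (R := ℝ) (φ := fun _ : Fin d => ℝ) l).analyticAt _)
  have h2 : AnalyticAt ℝ (fun η => D l (φ η)) 0 := (((D l).restrictScalars ℝ).analyticAt _).comp hφ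
  have h3 : AnalyticAt ℝ (fun η => J (φ η)) 0 := ((J.restrictScalars ℝ).analyticAt _).comp hφ
  exact ((((innerSL ℂ (J e)) ∘L m k l).restrictScalars ℝ).analyticAt _).comp (h2.add (h1.smul h3))

omit [CompleteSpace H] [CompleteSpace L] in
lemma analyticAt_re_meanFlux_of (e : H) (k : Fin d) {φ : (Fin d → ℝ) → H}
    (hφ : AnalyticAt ℝ φ 0) :
    AnalyticAt ℝ (fun η => (meanFlux D m J e k η (φ η)).re) 0 :=
  (Complex.reCLM.analyticAt _).comp (analyticAt_meanFlux e k hφ)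

omit [CompleteSpace H] [CompleteSpace L] in
/-- The derivative of the mean flux along a family through `e`. -/
lemma fderiv_meanFlux {e : H} (k l : Fin d) {φ : (Fin d → ℝ) → H}
    (hφ : DifferentiableAt ℝ φ 0) (hφ0 : φ 0 = e) :
    fderiv ℝ (fun η => (meanFlux D m J e k η (φ η)).re) 0 (Pi.single l 1) =
      (-Complex.I * (∑ n, inner ℂ (J e) (m k n (D n (fderiv ℝ φ 0 (Pi.single l 1)))) +
        Complex.I * inner ℂ (J e) (m k l (J e)))).re := by
  have hn : ∀ n, HasFDerivAt (fun η => inner ℂ (J e) (m k n (D n (φ η) +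
      (Complex.I * (η n : ℂ)) • J (φ η))))
      ((((innerSL ℂ (J e)) ∘L m k n).restrictScalars ℝ) ∘L
        (((D n).restrictScalars ℝ) ∘L fderiv ℝ φ 0 +
          ((Complex.I * ((0 : Fin d → ℝ) n : ℂ)) • ((J.restrictScalars ℝ) ∘L fderiv ℝ φ 0) +
            (Complex.I • (Complex.ofRealCLM ∘L ContinuousLinearMap.proj (R := ℝ)
              (φ := fun _ : Fin d => ℝ) n)).smulRight (J (φ 0))))) 0 := by
    intro n
    have h1 : HasFDerivAt (fun η : Fin d → ℝ => Complex.I * (η n : ℂ))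
        (Complex.I • (Complex.ofRealCLM ∘L ContinuousLinearMap.proj (R := ℝ)
          (φ := fun _ : Fin d => ℝ) n)) 0 :=
      (Complex.ofRealCLM ∘L ContinuousLinearMap.proj (R := ℝ)
        (φ := fun _ : Fin d => ℝ) n).hasFDerivAt.const_mul Complex.I
    have h2 : HasFDerivAt (fun η => D n (φ η)) (((D n).restrictScalars ℝ) ∘L fderiv ℝ φ 0) 0 :=
      ((D n).restrictScalars ℝ).hasFDerivAt.comp _ hφ.hasFDerivAt
    have h3 : HasFDerivAt (fun η => J (φ η)) ((J.restrictScalars ℝ) ∘L fderiv ℝ φ 0) 0 :=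
      (J.restrictScalars ℝ).hasFDerivAt.comp _ hφ.hasFDerivAt
    exact (((innerSL ℂ (J e)) ∘L m k n).restrictScalars ℝ).hasFDerivAt.comp _
      (h2.add (h1.smul h3))
  have h := Complex.reCLM.hasFDerivAt.comp (0 : Fin d → ℝ)
    ((HasFDerivAt.fun_sum fun n (_ : n ∈ Finset.univ) => hn n).const_mul (-Complex.I))
  have h' : HasFDerivAt (fun η => (meanFlux D m J e k η (φ η)).re) _ 0 := h
  rw [h'.fderiv, hφ0]
  simp only [ContinuousLinearMap.comp_apply, Complex.reCLM_apply, _root_.smul_apply,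
    _root_.sum_apply, _root_.add_apply, ContinuousLinearMap.coe_restrictScalars',
    ContinuousLinearMap.smulRight_apply, ContinuousLinearMap.proj_apply, Complex.ofRealCLM_apply,
    Pi.zero_apply, Complex.ofReal_zero, mul_zero, zero_smul, zero_add, map_add, map_smul,
    innerSL_apply_apply, smul_eq_mul, Finset.sum_add_distrib]
  congr 3
  rw [Finset.sum_eq_single l (fun n _ hn => by simp [hn]) (by simp)]
  simp

end QuadraticFamily

/-! ### Second-order calculus at a critical point -/

section CriticalPoint

variable {d : ℕ}

/-- The first two derivatives at `0` of `η ↦ ∑ j, η_j h_j(η)` when all `h_j` vanish at `0`. -/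
lemma pderiv_of_eq_sum_mul {f : (Fin d → ℝ) → ℝ} {h : Fin d → (Fin d → ℝ) → ℝ}
    (hh : ∀ j, AnalyticAt ℝ (h j) 0) (h0 : ∀ j, h j 0 = 0)
    (hf : ∀ᶠ η in 𝓝 0, f η = ∑ j, η j * h j η) :
    (∀ l, pderiv l f 0 = 0) ∧
      ∀ k l, pderiv k (pderiv l f) 0 = pderiv k (h l) 0 + pderiv l (h k) 0 := by
  have hfd : ∀ᶠ η in 𝓝 (0 : Fin d → ℝ), ∀ l, pderiv l f η =
      h l η + ∑ j, η j * pderiv l (h j) η := by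
    -- The gradient formula is differentiated once more, so it is needed on a whole neighbourhood of
    -- 0.
    have hd : ∀ᶠ η in 𝓝 (0 : Fin d → ℝ), ∀ j, DifferentiableAt ℝ (h j) η :=
      eventually_all.2 fun j => (hh j).eventually_analyticAt.mono fun η h => h.differentiableAt
    filter_upwards [hd, hf.eventually_nhds] with η hη hfη l
    have h1 : HasFDerivAt f (∑ j, (η j • fderiv ℝ (h j) η +
        h j η • ContinuousLinearMap.proj (R := ℝ) (φ := fun _ : Fin d => ℝ) j)) η := by
      refine HasFDerivAt.congr_of_eventuallyEq ?_ hfη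
      refine HasFDerivAt.fun_sum fun j _ => ?_
      exact (ContinuousLinearMap.proj (R := ℝ) (φ := fun _ : Fin d => ℝ) j).hasFDerivAt.mul
        (hη j).hasFDerivAt
    rw [pderiv, h1.fderiv]
    simp only [_root_.sum_apply, _root_.add_apply,
      _root_.smul_apply, ContinuousLinearMap.proj_apply, smul_eq_mul,
      Finset.sum_add_distrib]
    rw [add_comm]
    congr 1
    rw [Finset.sum_eq_single l (fun n _ hn => by simp [hn]) (by simp)]
    simp
  have hda : ∀ l j, DifferentiableAt ℝ (pderiv l (h j)) 0 := fun l j =>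
    ((ContinuousLinearMap.apply ℝ ℝ (Pi.single l 1 : Fin d → ℝ)).analyticAt _).comp
      (hh j).fderiv |>.differentiableAt
  refine ⟨fun l => ?_, fun k l => ?_⟩
  · rw [hfd.self_of_nhds l]
    simp [h0]
  · have h1 : HasFDerivAt (pderiv l f) (fderiv ℝ (h l) 0 + ∑ j, ((0 : Fin d → ℝ) j •
        fderiv ℝ (pderiv l (h j)) 0 + pderiv l (h j) 0 •
          ContinuousLinearMap.proj (R := ℝ) (φ := fun _ : Fin d => ℝ) j)) 0 := by
      refine HasFDerivAt.congr_of_eventuallyEq ?_ (hfd.mono fun η h => h l)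
      refine (hh l).differentiableAt.hasFDerivAt.add (HasFDerivAt.fun_sum fun j _ => ?_)
      exact (ContinuousLinearMap.proj (R := ℝ) (φ := fun _ : Fin d => ℝ) j).hasFDerivAt.mul
        (hda l j).hasFDerivAt
    rw [pderiv, h1.fderiv]
    simp only [_root_.sum_apply, _root_.add_apply,
      _root_.smul_apply, ContinuousLinearMap.proj_apply, smul_eq_mul, Pi.zero_apply,
      zero_mul, zero_add]
    congr 1
    rw [Finset.sum_eq_single k (fun n _ hn => by simp [hn]) (by simp)]
    simp

end CriticalPoint

/-! ### Fourier series on the cell, transported from the unit torus -/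

section Parseval

local instance : MeasureSpace UnitAddCircle := ⟨AddCircle.haarAddCircle⟩

/-- The section `UnitAddTorus → [0, 2π]^M` of the quotient map `y ↦ y / 2π`. -/
def torusLift {M : ℕ} (t : UnitAddTorus (Fin M)) : Fin M → ℝ :=
  (2 * Real.pi) • fun j => (AddCircle.equivIoc 1 0 (t j) : ℝ)

/-- The density `(2π)^{-M}`. -/
def cellDensity (M : ℕ) : ℝ := (2 * Real.pi)⁻¹ ^ M

lemma cellDensity_pos (M : ℕ) : 0 < cellDensity M := by
  unfold cellDensity; positivity

lemma measurePreserving_torusLift (M : ℕ) :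
    MeasurePreserving (torusLift (M := M)) volume
      (ENNReal.ofReal (cellDensity M) • volume.restrict (cell M)) := by
  have h2 : (0 : ℝ) < 2 * Real.pi := by positivity
  set U : Set (Fin M → ℝ) := {x | ∀ i, x i ∈ Set.Ioc (0 : ℝ) (0 + 1)} with hU
  have hUm : MeasurableSet U := MeasurableSet.univ_pi' fun _ => measurableSet_Ioc
  have h1 : MeasurePreserving (fun t : UnitAddTorus (Fin M) => fun j =>
      (AddCircle.equivIoc 1 0 (t j) : ℝ)) volume (volume.restrict U) := by
    have hA := UnitAddTorus.measurePreserving_equivPiIoc (fun _ : Fin M => (0 : ℝ))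
    have hB : MeasurePreserving (Subtype.val : U → Fin M → ℝ) (Measure.comap Subtype.val volume)
        (volume.restrict U) := ⟨measurable_subtype_coe, map_comap_subtype_coe hUm volume⟩
    exact hB.comp hA
  have h3 : MeasurePreserving (fun x : Fin M → ℝ => (2 * Real.pi) • x) (volume.restrict U)
      (ENNReal.ofReal (cellDensity M) • volume.restrict (cell M)) := by
    refine ⟨measurable_const_smul _, ?_⟩
    have hpre : (fun x : Fin M → ℝ => (2 * Real.pi) • x) ⁻¹'
        (Set.pi Set.univ fun _ => Set.Ioc 0 (2 * Real.pi)) = U := by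
      ext x
      simp only [Set.mem_preimage, Set.mem_pi, Set.mem_univ, true_imp_iff, hU, Set.mem_ofPred_eq,
        Set.mem_Ioc, Pi.smul_apply, smul_eq_mul, zero_add]
      refine forall_congr' fun i => and_congr ?_ ?_
      · exact ⟨fun h => by by_contra! h'; nlinarith, fun h => by positivity⟩
      · exact ⟨fun h => by by_contra! h'; nlinarith, fun h => by nlinarith⟩
    -- The lift uses half-open intervals closed on the right, the cell those closed on the left; the
    -- cubes differ by a null set.
    have hae : (Set.pi Set.univ fun _ => Set.Ioc 0 (2 * Real.pi) : Set (Fin M → ℝ))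
        =ᵐ[volume] cell M :=
      Measure.univ_pi_Ioc_ae_eq_Icc.trans Measure.univ_pi_Ico_ae_eq_Icc.symm
    have hm : MeasurableSet (Set.pi Set.univ fun _ => Set.Ioc 0 (2 * Real.pi) : Set (Fin M → ℝ)) :=
      MeasurableSet.univ_pi fun _ => measurableSet_Ioc
    rw [← hpre, ← Measure.restrict_map (measurable_const_smul _) hm,
      Measure.map_addHaar_smul volume h2.ne', Measure.restrict_smul, Measure.restrict_congr_set hae]
    congr 2
    rw [cellDensity, Module.finrank_fin_fun, abs_of_pos (by positivity), inv_pow]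
  exact h3.comp h1

lemma mFourier_neg_eq_expNeg {M : ℕ} (n : Fin M → ℤ) (t : UnitAddTorus (Fin M)) :
    UnitAddTorus.mFourier (-n) t = expNeg n (torusLift t) := by
  have h : ∀ j, fourier (-n j) (t j) =
      Complex.exp (-Complex.I * ((n j : ℂ) * (torusLift t j : ℂ))) := by
    intro j
    have ht : t j = ((AddCircle.equivIoc 1 0 (t j) : ℝ) : UnitAddCircle) :=
      ((AddCircle.equivIoc (1 : ℝ) 0).symm_apply_apply (t j)).symm
    conv_lhs => rw [ht]
    rw [fourier_coe_apply]
    congr 1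
    simp only [torusLift, Pi.smul_apply, smul_eq_mul]
    push_cast
    ring
  simp only [UnitAddTorus.mFourier, ContinuousMap.coe_mk, Pi.neg_apply, h, expNeg, Finset.mul_sum,
    Complex.exp_sum]

lemma integral_torusLift {M : ℕ} {E : Type*} [NormedAddCommGroup E] [NormedSpace ℝ E]
    {g : (Fin M → ℝ) → E} (hg : AEStronglyMeasurable g (volume.restrict (cell M))) :
    ∫ t, g (torusLift t) = cellDensity M • ∫ y in cell M, g y := by
  have hmp := measurePreserving_torusLift M
  rw [← integral_map hmp.measurable.aemeasurable, hmp.map_eq, integral_smul_measure,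
    ENNReal.toReal_ofReal (cellDensity_pos M).le]
  rw [hmp.map_eq]
  exact hg.smul_measure _

lemma continuous_expNeg {M : ℕ} (n : Fin M → ℤ) : Continuous (expNeg n) := by
  unfold expNeg; fun_prop

/-- Parseval's identity on the cell. -/
theorem hasSum_sq_fourierInt {M : ℕ} (f : L2 M) :
    HasSum (fun n => cellDensity M * ‖fourierInt f n‖ ^ 2) (‖f‖ ^ 2) := by
  have hmp := measurePreserving_torusLift M
  have hc := cellDensity_pos M
  have hF : MemLp (fun t => f (torusLift t)) 2 (volume : Measure (UnitAddTorus (Fin M))) :=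
    ((Lp.memLp f).smul_measure ENNReal.ofReal_ne_top).comp_measurePreserving hmp
  have h := UnitAddTorus.hasSum_sq_mFourierCoeff (hF.toLp _)
  have h1 : ∀ n, UnitAddTorus.mFourierCoeff (hF.toLp _) n = cellDensity M • fourierInt f n := by
    intro n
    rw [UnitAddTorus.mFourierCoeff, fourierInt,
      ← integral_torusLift (integrable_mul_expNeg f n).aestronglyMeasurable]
    refine integral_congr_ae ?_
    filter_upwards [hF.coeFn_toLp] with t ht
    rw [ht, mFourier_neg_eq_expNeg, smul_eq_mul, mul_comm]
  have h2 : ∫ t, ‖(hF.toLp _ : UnitAddTorus (Fin M) → ℂ) t‖ ^ 2 = cellDensity M * ‖f‖ ^ 2 := by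
    have h3 : ‖f‖ ^ 2 = ∫ y in cell M, ‖f y‖ ^ 2 := by
      have := inner_self_eq_ofReal f
      rw [L2.inner_def] at this
      have h4 : ∀ y, inner ℂ (f y) (f y) = ((‖f y‖ ^ 2 : ℝ) : ℂ) := fun y =>
        inner_self_eq_ofReal _
      simp only [h4] at this
      rw [integral_complex_ofReal] at this
      exact_mod_cast this.symm
    rw [h3, ← smul_eq_mul, ← integral_torusLift]
    · refine integral_congr_ae ?_
      filter_upwards [hF.coeFn_toLp] with t ht
      rw [ht]
    · exact ((Lp.memLp f).1.norm).pow 2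
  simp only [h1, norm_smul, Real.norm_eq_abs, abs_of_pos hc] at h
  rw [h2] at h
  have h5 := h.mul_left (cellDensity M)⁻¹
  rw [inv_mul_cancel_left₀ hc.ne'] at h5
  refine h5.congr_fun fun n => ?_
  field_simp

lemma integral_expNeg {M : ℕ} {n : Fin M → ℤ} (hn : n ≠ 0) : ∫ y in cell M, expNeg n y = 0 := by
  have hc := cellDensity_pos M
  have h1 := integral_torusLift (M := M)
    ((continuous_expNeg n).aestronglyMeasurable (μ := volume.restrict (cell M)))
  have h2 : ∫ t, expNeg n (torusLift t) = 0 := by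
    simp only [← mFourier_neg_eq_expNeg]
    have h3 := (orthonormal_iff_ite.1 (UnitAddTorus.orthonormal_mFourier (d := Fin M))) n 0
    rw [if_neg hn] at h3
    simpa only [ContinuousMap.inner_toLp, ← UnitAddTorus.mFourier_neg, UnitAddTorus.mFourier_zero,
      ContinuousMap.one_apply, mul_one, one_mul] using h3
  rw [h2] at h1
  exact (smul_eq_zero.1 h1.symm).resolve_left hc.ne'

end Parseval
-- The Hilbert space `H¹_♯(Q)` and the Poincaré–Wirtinger inequality
section H1

variable {M : ℕ}

instance isFiniteMeasure_restrict_cell (M : ℕ) : IsFiniteMeasure (volume.restrict (cell M)) :=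
  ⟨by simpa using volume_cell_lt_top M⟩

lemma inner_L2_eq (f g : L2 M) : inner ℂ f g = ∫ y in cell M, g y * conj (f y) := by
  rw [L2.inner_def]
  simp only [RCLike.inner_apply]

/-- The Fourier coefficient as a linear functional on `L²(Q)`. -/
def fourierIntₗ (n : Fin M → ℤ) : L2 M →ₗ[ℂ] ℂ where
  toFun f := fourierInt f n
  map_add' f g := fourierInt_add f g n
  map_smul' c f := fourierInt_smul c f n

/-- A single term of Parseval's sum bounds the coefficient. This continuity makes `H1 M` closed,
hence complete. -/
lemma continuous_fourierInt (n : Fin M → ℤ) : Continuous fun f : L2 M => fourierInt f n := by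
  have hc := cellDensity_pos M
  refine AddMonoidHomClass.continuous_of_bound (fourierIntₗ n) (Real.sqrt (cellDensity M)⁻¹)
    fun f => ?_
  have h := le_hasSum (hasSum_sq_fourierInt f) n fun m _ => by positivity
  refine abs_le_of_sq_le_sq' ?_ (by positivity) |>.2
  rw [mul_pow, Real.sq_sqrt (by positivity), inv_mul_eq_div, le_div_iff₀ hc, mul_comm]
  exact h

lemma isClosed_H1 (M : ℕ) :
    IsClosed (H1 M : Set (WithLp 2 (L2 M × PiLp 2 fun _ : Fin M => L2 M))) := by
  have : (H1 M : Set (WithLp 2 (L2 M × PiLp 2 fun _ : Fin M => L2 M))) = ⋂ j : Fin M,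
      ⋂ n : Fin M → ℤ, {p |
        fourierInt (p.snd j) n = Complex.I * (n j : ℂ) * fourierInt p.fst n} := by
    ext p
    simp [H1]
  rw [this]
  refine isClosed_iInter fun j => isClosed_iInter fun n => isClosed_eq ?_ ?_
  · exact (continuous_fourierInt n).comp (by fun_prop)
  · exact continuous_const.mul ((continuous_fourierInt n).comp (by fun_prop))

instance completeSpace_H1 (M : ℕ) : CompleteSpace (H1 M) :=
  (isClosed_H1 M).completeSpace_coe

/-- The Hilbert space `H¹_♯(Q)`. This is `H1 M` with opaque instances. -/
def HS (M : ℕ) : Type := H1 M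

instance (M : ℕ) : NormedAddCommGroup (HS M) := inferInstanceAs (NormedAddCommGroup (H1 M))

instance (M : ℕ) : InnerProductSpace ℂ (HS M) := inferInstanceAs (InnerProductSpace ℂ (H1 M))

instance (M : ℕ) : CompleteSpace (HS M) := inferInstanceAs (CompleteSpace (H1 M))

/-- The inclusion `H¹_♯(Q) → L²(Q)`. -/
def valL (M : ℕ) : HS M →L[ℂ] L2 M := show H1 M →L[ℂ] L2 M from
  WithLp.fstL 2 ℂ (L2 M) (PiLp 2 fun _ : Fin M => L2 M) ∘L (H1 M).subtypeL

/-- The partial derivative `∂_j : H¹_♯(Q) → L²(Q)`. -/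
def dyL (j : Fin M) : HS M →L[ℂ] L2 M := show H1 M →L[ℂ] L2 M from
  PiLp.proj 2 (fun _ : Fin M => L2 M) j ∘L
    WithLp.sndL 2 ℂ (L2 M) (PiLp 2 fun _ : Fin M => L2 M) ∘L (H1 M).subtypeL

lemma coe_dyL (j : Fin M) (u : HS M) : (dyL j u : (Fin M → ℝ) → ℂ) = dy j u := rfl

lemma fourierInt_dyL (j : Fin M) (u : HS M) (n : Fin M → ℤ) :
    fourierInt (dyL j u) n = Complex.I * (n j : ℂ) * fourierInt (valL M u) n :=
  u.2 j n

lemma norm_sq_H1 (u : HS M) : ‖u‖ ^ 2 = ‖valL M u‖ ^ 2 + ∑ j, ‖dyL j u‖ ^ 2 := by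
  have h : ∀ w : H1 M, ‖w‖ ^ 2 = ‖w.1.fst‖ ^ 2 + ∑ j, ‖w.1.snd j‖ ^ 2 := fun w => by
    rw [← Submodule.norm_coe, WithLp.prod_norm_sq_eq_of_L2, PiLp.norm_sq_eq_of_L2]
  exact h u

lemma H1_ext {u v : HS M} (h0 : valL M u = valL M v) (h1 : ∀ j, dyL j u = dyL j v) : u = v := by
  rw [← sub_eq_zero, ← norm_eq_zero, ← pow_eq_zero_iff two_ne_zero, norm_sq_H1]
  simp [h0, h1]

/-- The constant function `1` in `L²(Q)`. -/
def oneL2 (M : ℕ) : L2 M := (memLp_const (1 : ℂ)).toLp fun _ => 1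

lemma coeFn_oneL2 (M : ℕ) : oneL2 M =ᵐ[volume.restrict (cell M)] fun _ => 1 :=
  MemLp.coeFn_toLp _

lemma fourierInt_oneL2 {n : Fin M → ℤ} (hn : n ≠ 0) : fourierInt (oneL2 M) n = 0 := by
  rw [← integral_expNeg hn, fourierInt]
  refine integral_congr_ae ?_
  filter_upwards [coeFn_oneL2 M] with y hy
  rw [hy, one_mul]

/-- The constant function `1` in `H¹_♯(Q)`. -/
def oneH1 (M : ℕ) : HS M := show H1 M from ⟨WithLp.toLp 2 (oneL2 M, 0), by
  intro j n
  change fourierInt (0 : L2 M) n = _ * fourierInt (oneL2 M) n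
  rw [fourierInt_zero]
  by_cases hn : n = 0
  · simp [hn]
  · rw [fourierInt_oneL2 hn, mul_zero]⟩

lemma valL_oneH1 (M : ℕ) : valL M (oneH1 M) = oneL2 M := rfl

lemma dyL_oneH1 (j : Fin M) : dyL j (oneH1 M) = 0 := rfl

lemma volume_real_cell_pos (M : ℕ) : 0 < volume.real (cell M) := by
  rw [Measure.real, cell, Real.volume_pi_Ico_toReal]
  · exact Finset.prod_pos fun _ _ => by rw [sub_zero]; positivity
  · intro _; positivity

lemma norm_sq_oneL2 (M : ℕ) : ‖oneL2 M‖ ^ 2 = volume.real (cell M) := by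
  have h := inner_self_eq_ofReal (oneL2 M)
  rw [inner_L2_eq] at h
  have h2 : ∫ y in cell M, oneL2 M y * conj (oneL2 M y) = (volume.real (cell M) : ℂ) := by
    rw [← one_smul ℝ (volume.real (cell M) : ℂ)]
    trans ∫ y in cell M, (1 : ℂ)
    · refine integral_congr_ae ?_
      filter_upwards [coeFn_oneL2 M] with y hy
      simp [hy]
    · simp
  rw [h2] at h
  exact_mod_cast h.symm

/-- Parseval for the constant 1, whose only nonzero coefficient is at n = 0 and equals ‖1‖²; thus
‖1‖² = `cellDensity M` ‖1‖⁴. -/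
lemma norm_sq_oneL2_eq_inv (M : ℕ) : ‖oneL2 M‖ ^ 2 = (cellDensity M)⁻¹ := by
  have h := hasSum_sq_fourierInt (oneL2 M)
  have h0 : fourierInt (oneL2 M) 0 = ((‖oneL2 M‖ ^ 2 : ℝ) : ℂ) := by
    rw [← inner_self_eq_ofReal, inner_L2_eq, fourierInt]
    refine integral_congr_ae ?_
    filter_upwards [coeFn_oneL2 M] with y hy
    simp [hy, expNeg]
  have h1 := h.unique (hasSum_single 0 fun n hn => by rw [fourierInt_oneL2 hn]; simp)
  rw [h0, Complex.norm_real, norm_pow, norm_norm] at h1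
  have hV := volume_real_cell_pos M
  rw [← norm_sq_oneL2] at hV
  have : 1 = cellDensity M * ‖oneL2 M‖ ^ 2 := by
    apply mul_right_cancel₀ hV.ne'
    linarith
  exact eq_inv_of_mul_eq_one_right this.symm

lemma oneL2_ne_zero (M : ℕ) : oneL2 M ≠ 0 := by
  intro h
  have := volume_real_cell_pos M
  rw [← norm_sq_oneL2, h] at this
  simp at this

lemma fourierInt_zero_eq_inner (f : L2 M) : fourierInt f 0 = inner ℂ (oneL2 M) f := by
  rw [inner_L2_eq, fourierInt]
  refine integral_congr_ae ?_
  filter_upwards [coeFn_oneL2 M] with y hy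
  simp [hy, expNeg]

/-- The Poincaré–Wirtinger inequality on the cell. -/
theorem poincare (u : HS M) : ‖oneL2 M‖ ^ 2 * ‖valL M u‖ ^ 2 ≤
    ‖oneL2 M‖ ^ 2 * (‖u‖ ^ 2 - ‖valL M u‖ ^ 2) + ‖inner ℂ (oneL2 M) (valL M u)‖ ^ 2 := by
  have hc := cellDensity_pos M
  have h1 := hasSum_sq_fourierInt (valL M u)
  have h2 : HasSum (fun n => ∑ j, cellDensity M * ‖fourierInt (dyL j u) n‖ ^ 2)
      (∑ j, ‖dyL j u‖ ^ 2) := hasSum_sum fun j _ => hasSum_sq_fourierInt (dyL j u)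
  have h3 : HasSum (fun n => if n = 0 then cellDensity M * ‖fourierInt (valL M u) n‖ ^ 2 else 0)
      (cellDensity M * ‖fourierInt (valL M u) 0‖ ^ 2) := by
    have := hasSum_ite_eq (0 : Fin M → ℤ) (cellDensity M * ‖fourierInt (valL M u) 0‖ ^ 2)
    refine this.congr_fun fun n => ?_
    split_ifs with h <;> simp [h]
  -- Compared mode by mode: the mean accounts for n = 0, and for n ≠ 0 some |n_j| ≥ 1 makes that
  -- derivative's coefficient at least as large as that of u.
  have h4 := hasSum_le (fun n => ?_) h1 (h2.add h3)
  · rw [norm_sq_H1, norm_sq_oneL2_eq_inv, ← fourierInt_zero_eq_inner]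
    calc (cellDensity M)⁻¹ * ‖valL M u‖ ^ 2 ≤ (cellDensity M)⁻¹ *
          (∑ j, ‖dyL j u‖ ^ 2 + cellDensity M * ‖fourierInt (valL M u) 0‖ ^ 2) := by gcongr
      _ = _ := by rw [mul_add, inv_mul_cancel_left₀ hc.ne', add_sub_cancel_left]
  · by_cases hn : n = 0
    · simp only [hn, if_true]
      exact le_add_of_nonneg_left (Finset.sum_nonneg fun j _ => by positivity)
    · rw [if_neg hn, add_zero]
      obtain ⟨j, hj⟩ := Function.ne_iff.1 hn
      refine le_trans ?_ (Finset.single_le_sum (f := fun j =>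
        cellDensity M * ‖fourierInt (dyL j u) n‖ ^ 2) (fun j _ => by positivity)
        (Finset.mem_univ j))
      simp only [fourierInt_dyL, norm_mul, Complex.norm_I, one_mul]
      have h5 : (1 : ℝ) ≤ ‖(n j : ℂ)‖ := by
        rw [Complex.norm_intCast]
        exact_mod_cast Int.one_le_abs hj
      gcongr
      exact le_mul_of_one_le_left (norm_nonneg _) h5

end H1

/-! ### Kronecker's theorem and the transfer of hypotheses from A to B -/

section Kronecker

open UnitAddTorus

variable {M : ℕ} {G : Type*} [AddCommGroup G] [TopologicalSpace G] [CompactSpace G]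
  [IsTopologicalAddGroup G] [MeasurableSpace G] [BorelSpace G]

/-- Integration of continuous functions on the torus pulled back along a continuous map. -/
def pullbackIntegral (μ : Measure G) [IsProbabilityMeasure μ] (g : C(G, UnitAddTorus (Fin M))) :
    C(UnitAddTorus (Fin M), ℂ) →L[ℂ] ℂ :=
  LinearMap.mkContinuous
    { toFun := fun f => ∫ x, f (g x) ∂μ
      map_add' := fun f₁ f₂ => integral_add
        ((f₁.comp g).continuous.integrable_of_hasCompactSupport
          (HasCompactSupport.of_compactSpace _))
        ((f₂.comp g).continuous.integrable_of_hasCompactSupport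
          (HasCompactSupport.of_compactSpace _))
      map_smul' := fun c f => integral_const_mul c _ } 1 fun f => by
    have := norm_integral_le_of_norm_le_const (μ := μ) (f := fun x => f (g x)) (C := ‖f‖)
      (Eventually.of_forall fun x => f.norm_coe_le_norm _)
    simpa using this

omit [AddCommGroup G] [IsTopologicalAddGroup G] in
lemma pullbackIntegral_apply (μ : Measure G) [IsProbabilityMeasure μ]
    (g : C(G, UnitAddTorus (Fin M))) (f : C(UnitAddTorus (Fin M), ℂ)) :
    pullbackIntegral μ g f = ∫ x, f (g x) ∂μ := rfl

lemma mFourier_apply_add (n : Fin M → ℤ) (s t : UnitAddTorus (Fin M)) :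
    mFourier n (s + t) = mFourier n s * mFourier n t := by
  simp only [mFourier, ContinuousMap.coe_mk, Pi.add_apply, fourier_apply, smul_add,
    AddCircle.toCircle_add, Circle.coe_mul, Finset.prod_mul_distrib]

/-- Translating by a point where the character is not 1 multiplies the integral by a factor
different from 1, yet leaves it unchanged. -/
lemma pullbackIntegral_mFourier (μ : Measure G) [IsProbabilityMeasure μ] [μ.IsAddLeftInvariant]
    (g : C(G, UnitAddTorus (Fin M))) (hg : ∀ x y, g (x + y) = g x + g y)
    (hn : ∀ n : Fin M → ℤ, n ≠ 0 → ∃ x, mFourier n (g x) ≠ 1) (n : Fin M → ℤ) :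
    pullbackIntegral μ g (mFourier n) = if n = 0 then 1 else 0 := by
  split_ifs with h
  · simp [pullbackIntegral_apply, h, mFourier_zero]
  · obtain ⟨x₀, hx₀⟩ := hn n h
    rw [pullbackIntegral_apply]
    have h1 := integral_add_left_eq_self (μ := μ) (fun x => mFourier n (g x)) x₀
    simp only [hg, mFourier_apply_add, integral_const_mul] at h1
    have h2 : (mFourier n (g x₀) - 1) * ∫ x, mFourier n (g x) ∂μ = 0 := by
      rw [sub_mul, h1, one_mul, sub_self]
    exact (mul_eq_zero.1 h2).resolve_left (sub_ne_zero.2 hx₀)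

/-- A closed subgroup of the torus on which no nontrivial character is trivial is everything. -/
theorem addSubgroup_eq_top_of_mFourier (K : AddSubgroup (UnitAddTorus (Fin M)))
    (hK : IsClosed (K : Set (UnitAddTorus (Fin M))))
    (hn : ∀ n : Fin M → ℤ, n ≠ 0 → ∃ x ∈ K, mFourier n x ≠ 1) : K = ⊤ := by
  have : CompactSpace K := isCompact_iff_compactSpace.1 hK.isCompact
  set μ : Measure K := Measure.addHaarMeasure ⊤ with hμ
  set ν : Measure (UnitAddTorus (Fin M)) := Measure.addHaarMeasure ⊤ with hν
  have : IsProbabilityMeasure μ := ⟨by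
    rw [← TopologicalSpace.PositiveCompacts.coe_top]; exact Measure.addHaarMeasure_self⟩
  have : IsProbabilityMeasure ν := ⟨by
    rw [← TopologicalSpace.PositiveCompacts.coe_top]; exact Measure.addHaarMeasure_self⟩
  set i : C(K, UnitAddTorus (Fin M)) := ⟨Subtype.val, continuous_subtype_val⟩ with hi
  -- Haar measure of K, pushed to the torus, agrees with Haar measure of the torus on characters,
  -- whose span is dense.
  have h : pullbackIntegral μ i = pullbackIntegral ν (ContinuousMap.id _) := by
    refine ContinuousLinearMap.ext_on (s := Set.range (mFourier (d := Fin M))) ?_ ?_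
    · exact Submodule.dense_iff_topologicalClosure_eq_top.2 span_mFourier_closure_eq_top
    · rintro _ ⟨n, rfl⟩
      rw [pullbackIntegral_mFourier μ i (fun _ _ => rfl),
        pullbackIntegral_mFourier ν _ fun _ _ => rfl]
      · intro n hne
        obtain ⟨x, -, hx⟩ := hn n hne
        exact ⟨x, hx⟩
      · intro n hne
        obtain ⟨x, hxK, hx⟩ := hn n hne
        exact ⟨⟨x, hxK⟩, hx⟩
  -- The distance to K has zero integral over K, hence over the torus; being continuous and
  -- nonnegative, it vanishes everywhere.
  set F : UnitAddTorus (Fin M) → ℝ := fun x => Metric.infDist x K with hF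
  have hFc : Continuous F := Metric.continuous_infDist_pt _
  have h1 := DFunLike.congr_fun h (⟨fun x => (F x : ℂ), by fun_prop⟩ : C(UnitAddTorus (Fin M), ℂ))
  simp only [pullbackIntegral_apply, ContinuousMap.coe_mk, ContinuousMap.id_apply, hi] at h1
  have h2 : ∀ x : K, F x = 0 := fun x => Metric.infDist_zero_of_mem x.2
  simp only [h2, Complex.ofReal_zero, integral_zero] at h1
  rw [integral_complex_ofReal] at h1
  have h3 : ∫ x, F x ∂ν = 0 := by exact_mod_cast h1.symm
  rw [integral_eq_zero_iff_of_nonneg (fun x => Metric.infDist_nonneg)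
    (hFc.integrable_of_hasCompactSupport (HasCompactSupport.of_compactSpace _))] at h3
  have h4 : F = fun _ => 0 := (hFc.ae_eq_iff_eq ν continuous_const).1 h3
  rw [eq_top_iff]
  intro x _
  have := (Metric.mem_closure_iff_infDist_zero ⟨0, K.zero_mem⟩).2 (congrFun h4 x)
  rwa [hK.closure_eq] at this

/-- The quotient map `ℝ^M → (ℝ/ℤ)^M`, `y ↦ y / 2π`. -/
def toTorus : (Fin M → ℝ) →+ UnitAddTorus (Fin M) where
  toFun y j := ((y j / (2 * Real.pi) : ℝ) : UnitAddCircle)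
  map_zero' := by ext j; simp
  map_add' y z := by ext j; simp [add_div]

lemma mFourier_toTorus (n : Fin M → ℤ) (y : Fin M → ℝ) :
    mFourier n (toTorus y) = Complex.exp (Complex.I * ((∑ j, (n j : ℝ) * y j : ℝ) : ℂ)) := by
  have h : ∀ j, fourier (n j) (toTorus y j) =
      Complex.exp (Complex.I * ((n j : ℂ) * (y j : ℂ))) := by
    intro j
    change fourier (n j) ((y j / (2 * Real.pi) : ℝ) : UnitAddCircle) = _
    rw [fourier_coe_apply]
    congr 1
    have := Complex.ofReal_ne_zero.2 Real.pi_ne_zero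
    push_cast
    field_simp
  simp only [mFourier, ContinuousMap.coe_mk, h, ← Complex.exp_sum]
  push_cast
  rw [Finset.mul_sum]

lemma isOpenMap_toTorus : IsOpenMap (toTorus : (Fin M → ℝ) → UnitAddTorus (Fin M)) := by
  have h : IsOpenMap (fun y : ℝ => ((y / (2 * Real.pi) : ℝ) : UnitAddCircle)) :=
    QuotientAddGroup.isOpenMap_coe.comp
      (Homeomorph.mulRight₀ (2 * Real.pi)⁻¹ (by positivity)).isOpenMap
  exact IsOpenMap.piMap (fun _ => h) (by simp)

/-- **Kronecker's theorem**: if `Λᵀ p ≠ 0` for all nonzero integer `p`, then a periodic closed set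
containing the range of `Λ` is everything. -/
theorem mem_of_irrational_slope {d : ℕ} {Λ : Matrix (Fin M) (Fin d) ℝ}
    (hΛ : ∀ p : Fin M → ℤ, p ≠ 0 → Λᵀ *ᵥ (fun j => (p j : ℝ)) ≠ 0) {C : Set (Fin M → ℝ)}
    (hC : IsClosed C)
    (hper : ∀ (y : Fin M → ℝ) (n : Fin M → ℤ), y ∈ C → (fun j => y j + 2 * Real.pi * n j) ∈ C)
    (hline : ∀ x : Fin d → ℝ, Λ *ᵥ x ∈ C) (y : Fin M → ℝ) : y ∈ C := by
  set R : AddSubgroup (UnitAddTorus (Fin M)) :=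
    (toTorus.comp (Matrix.mulVecLin Λ).toAddMonoidHom).range with hR
  have htop : R.topologicalClosure = ⊤ := by
    refine addSubgroup_eq_top_of_mFourier _ R.isClosed_topologicalClosure fun n hn => ?_
    obtain ⟨i, hi⟩ := Function.ne_iff.1 (hΛ n hn)
    set w := Λᵀ *ᵥ (fun j => (n j : ℝ)) with hw
    -- Chosen so that n · Λx = π, where the character takes the value -1.
    set x : Fin d → ℝ := Pi.single i (Real.pi / w i) with hx
    refine ⟨toTorus (Λ *ᵥ x), R.le_topologicalClosure ⟨x, rfl⟩, ?_⟩
    have h1 : ∑ j, (n j : ℝ) * (Λ *ᵥ x) j = Real.pi := by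
      change (fun j => (n j : ℝ)) ⬝ᵥ (Λ *ᵥ x) = _
      rw [Matrix.dotProduct_mulVec, ← Matrix.mulVec_transpose, ← hw, hx, dotProduct_single]
      exact mul_div_cancel₀ _ hi
    rw [mFourier_toTorus, h1, mul_comm, Complex.exp_pi_mul_I]
    norm_num
  have hdense : Dense (toTorus ⁻¹' (R : Set (UnitAddTorus (Fin M))) : Set (Fin M → ℝ)) := by
    refine Dense.preimage ?_ isOpenMap_toTorus
    rw [dense_iff_closure_eq, ← AddSubgroup.topologicalClosure_coe, htop, AddSubgroup.coe_top]
  have hsub : (toTorus ⁻¹' (R : Set (UnitAddTorus (Fin M))) : Set (Fin M → ℝ)) ⊆ C := by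
    rintro z ⟨x, hx⟩
    have h1 : ∀ j, ∃ n : ℤ, z j = (Λ *ᵥ x) j + 2 * Real.pi * n := by
      intro j
      have h2 : (((Λ *ᵥ x) j / (2 * Real.pi) : ℝ) : UnitAddCircle) =
          ((z j / (2 * Real.pi) : ℝ) : UnitAddCircle) := congrFun hx j
      rw [eq_comm, ← sub_eq_zero, ← AddCircle.coe_sub, AddCircle.coe_eq_zero_iff] at h2
      obtain ⟨n, hn⟩ := h2
      refine ⟨n, ?_⟩
      have := Real.pi_ne_zero
      rw [zsmul_eq_mul, mul_one] at hn
      field_simp at hn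
      linarith
    choose n hn using h1
    have := hper _ n (hline x)
    rwa [← funext hn] at this
  exact hC.closure_subset_iff.2 hsub (hdense y)

variable {d : ℕ} {A : (Fin d → ℝ) → Matrix (Fin d) (Fin d) ℝ}
  {B : (Fin M → ℝ) → Matrix (Fin d) (Fin d) ℝ} {Λ : Matrix (Fin M) (Fin d) ℝ}

lemma IsQuasiperiodicCoeff.lift_symm (h : IsQuasiperiodicCoeff A B Λ) (y : Fin M → ℝ)
    (k l : Fin d) : B y k l = B y l k := by
  refine mem_of_irrational_slope h.irrational_slope (C := {y | B y k l = B y l k})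
    (isClosed_eq (h.lift_smooth k l).continuous (h.lift_smooth l k).continuous)
    (fun y n hy => ?_) (fun x => ?_) y
  · simpa [h.lift_periodic] using hy
  · have := (h.symmetric x).apply l k
    rwa [h.lift_eq] at this

/-- Continuity upgrades the almost everywhere bound on A to every x, and Kronecker's theorem extends
it to every y. -/
lemma IsQuasiperiodicCoeff.lift_nonneg (h : IsQuasiperiodicCoeff A B Λ) (y : Fin M → ℝ)
    (v : Fin d → ℝ) : 0 ≤ (B y *ᵥ v) ⬝ᵥ v := by
  have hB : Continuous B := continuous_matrix fun k l => (h.lift_smooth k l).continuous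
  have hA : Continuous A := continuous_matrix fun k l => (h.smooth k l).continuous
  refine mem_of_irrational_slope h.irrational_slope (C := {y | 0 ≤ (B y *ᵥ v) ⬝ᵥ v})
    (isClosed_le continuous_const (by fun_prop)) (fun y n hy => ?_) (fun x => ?_) y
  · simpa [h.lift_periodic] using hy
  · obtain ⟨α, hα, hco⟩ := h.coercive
    have hcl : IsClosed {x | 0 ≤ (A x *ᵥ v) ⬝ᵥ v} := isClosed_le continuous_const (by fun_prop)
    have hd : Dense {x | 0 ≤ (A x *ᵥ v) ⬝ᵥ v} := by
      refine Measure.dense_of_ae ((hco v).mono fun x hx => le_trans ?_ hx)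
      exact mul_nonneg hα.le (Finset.sum_nonneg fun i _ => mul_self_nonneg _)
    have := hcl.closure_subset (hd x)
    simpa only [Set.mem_ofPred_eq, h.lift_eq] using this

end Kronecker

/-! ### Multiplication and differentiation operators and their forms -/

section Operators

open ContinuousLinearMap

variable {d M : ℕ}

lemma memLp_top_cell (b : C(Fin M → ℝ, ℝ)) :
    MemLp (fun y => (b y : ℂ)) ⊤ (volume.restrict (cell M)) := by
  have hK : IsCompact (Set.Icc (fun _ => 0) fun _ => 2 * Real.pi : Set (Fin M → ℝ)) := isCompact_Icc
  have hbc : Continuous fun y => (b y : ℂ) := by fun_prop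
  obtain ⟨C, hC⟩ := hK.exists_bound_of_continuousOn hbc.continuousOn
  refine memLp_top_of_bound hbc.aestronglyMeasurable C ?_
  refine (ae_restrict_iff' ?_).2 (Eventually.of_forall fun y hy => hC y ?_)
  · exact MeasurableSet.univ_pi fun _ => measurableSet_Ico
  · exact ⟨fun j => (hy j trivial).1, fun j => (hy j trivial).2.le⟩

/-- Multiplication by a continuous real function on `L²(Q)`. -/
def mulL (b : C(Fin M → ℝ, ℝ)) : L2 M →L[ℂ] L2 M :=
  (ContinuousLinearMap.mul ℂ ℂ).holderL (volume.restrict (cell M)) ⊤ 2 2 ((memLp_top_cell b).toLp _)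

lemma coeFn_mulL (b : C(Fin M → ℝ, ℝ)) (f : L2 M) :
    mulL b f =ᵐ[volume.restrict (cell M)] fun y => (b y : ℂ) * f y := by
  have h := (ContinuousLinearMap.mul ℂ ℂ).coeFn_holder (r := 2) ((memLp_top_cell b).toLp _) f
  filter_upwards [h, (memLp_top_cell b).coeFn_toLp] with y h1 h2
  refine Eq.trans h1 ?_
  rw [h2, ContinuousLinearMap.mul_apply']

lemma integrable_mul_conj (f g : L2 M) :
    Integrable (fun y => f y * conj (g y)) (volume.restrict (cell M)) := by
  have := L2.integrable_inner (𝕜 := ℂ) g f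
  simpa only [RCLike.inner_apply] using this

lemma inner_mulL (b : C(Fin M → ℝ, ℝ)) (f g : L2 M) :
    inner ℂ g (mulL b f) = ∫ y in cell M, (b y : ℂ) * f y * conj (g y) := by
  rw [inner_L2_eq]
  refine integral_congr_ae ?_
  filter_upwards [coeFn_mulL b f] with y hy
  rw [hy]

lemma integrable_mulL (b : C(Fin M → ℝ, ℝ)) (f g : L2 M) :
    Integrable (fun y => (b y : ℂ) * f y * conj (g y)) (volume.restrict (cell M)) := by
  refine (integrable_mul_conj (mulL b f) g).congr ?_
  filter_upwards [coeFn_mulL b f] with y hy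
  rw [hy]

lemma inner_mulL_conj (b : C(Fin M → ℝ, ℝ)) (f g : L2 M) :
    conj (inner ℂ g (mulL b f)) = inner ℂ f (mulL b g) := by
  rw [inner_mulL, inner_mulL, ← integral_conj]
  refine integral_congr_ae (Eventually.of_forall fun y => ?_)
  simp only [map_mul, Complex.conj_ofReal, Complex.conj_conj]
  ring

/-- The sesquilinear form `∑ k l, ⟪g k, b k l f l⟫`. -/
def coeffForm (b : Fin d → Fin d → C(Fin M → ℝ, ℝ)) (f g : Fin d → L2 M) : ℂ :=
  ∑ k, ∑ l, inner ℂ (g k) (mulL (b k l) (f l))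

lemma coeffForm_eq_integral (b : Fin d → Fin d → C(Fin M → ℝ, ℝ)) (f g : Fin d → L2 M) :
    coeffForm b f g = ∫ y in cell M, ∑ k, ∑ l, (b k l y : ℂ) * f l y * conj (g k y) := by
  rw [integral_finsetSum _ fun k _ => integrable_finsetSum _ fun l _ => integrable_mulL _ _ _]
  refine Finset.sum_congr rfl fun k _ => ?_
  rw [integral_finsetSum _ fun l _ => integrable_mulL _ _ _]
  exact Finset.sum_congr rfl fun l _ => inner_mulL _ _ _

lemma coeffForm_conj {b : Fin d → Fin d → C(Fin M → ℝ, ℝ)} (hb : ∀ k l, b k l = b l k)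
    (f g : Fin d → L2 M) : conj (coeffForm b f g) = coeffForm b g f := by
  simp only [coeffForm, map_sum, inner_mulL_conj]
  rw [Finset.sum_comm]
  simp only [hb]

/-- The real part of the integrand is the real quadratic form evaluated at the real parts plus the
same form at the imaginary parts. -/
lemma coeffForm_nonneg {b : Fin d → Fin d → C(Fin M → ℝ, ℝ)}
    (hb : ∀ (y : Fin M → ℝ) (v : Fin d → ℝ), 0 ≤ ∑ k, ∑ l, b k l y * v l * v k)
    (f : Fin d → L2 M) : 0 ≤ (coeffForm b f f).re := by
  rw [coeffForm_eq_integral]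
  have hint : Integrable (fun y => ∑ k, ∑ l, (b k l y : ℂ) * f l y * conj (f k y))
      (volume.restrict (cell M)) :=
    integrable_finsetSum _ fun k _ => integrable_finsetSum _ fun l _ => integrable_mulL _ _ _
  have h := integral_re hint
  simp only [RCLike.re_eq_complex_re] at h
  rw [← h]
  refine integral_nonneg fun y => ?_
  have h1 := hb y fun k => (f k y).re
  have h2 := hb y fun k => (f k y).im
  refine (add_nonneg h1 h2).trans_eq ?_
  simp only [Complex.re_sum, ← Finset.sum_add_distrib]
  refine Finset.sum_congr rfl fun k _ => Finset.sum_congr rfl fun l _ => ?_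
  simp

/-- The operator `D_k = ∑ j, Λ_{jk} ∂_j`. -/
def dLamL (Λ : Matrix (Fin M) (Fin d) ℝ) (k : Fin d) : HS M →L[ℂ] L2 M :=
  ∑ j, (Λ j k : ℂ) • dyL j

lemma coeFn_dLamL (Λ : Matrix (Fin M) (Fin d) ℝ) (k : Fin d) (u : HS M) :
    dLamL Λ k u =ᵐ[volume.restrict (cell M)] dLam Λ u k := by
  have h1 : dLamL Λ k u = ∑ j, (Λ j k : ℂ) • dyL j u := by
    simp only [dLamL, _root_.sum_apply, _root_.smul_apply]
  rw [h1]
  have h2 := Lp.coeFn_finsetSum (p := 2) (μ := volume.restrict (cell M)) Finset.univ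
    fun j => (Λ j k : ℂ) • dyL j u
  have h3 : ∀ᵐ y ∂volume.restrict (cell M), ∀ j : Fin M,
      ((Λ j k : ℂ) • dyL j u : L2 M) y = (Λ j k : ℂ) * dy j u y :=
    ae_all_iff.2 fun j => Lp.coeFn_smul _ _
  filter_upwards [h2, h3] with y h2 h3
  rw [h2, Finset.sum_apply]
  exact Finset.sum_congr rfl fun j _ => h3 j

lemma dLamL_oneH1 (Λ : Matrix (Fin M) (Fin d) ℝ) (k : Fin d) : dLamL Λ k (oneH1 M) = 0 := by
  simp only [dLamL, _root_.sum_apply, _root_.smul_apply, dyL_oneH1, smul_zero,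
    Finset.sum_const_zero]

/-- The operator `D_k + i η_k`. -/
def dShiftL (Λ : Matrix (Fin M) (Fin d) ℝ) (η : Fin d → ℝ) (k : Fin d) : HS M →L[ℂ] L2 M :=
  dLamL Λ k + (Complex.I * (η k : ℂ)) • valL M

lemma dShiftL_apply (Λ : Matrix (Fin M) (Fin d) ℝ) (η : Fin d → ℝ) (k : Fin d) (u : HS M) :
    dShiftL Λ η k u = dLamL Λ k u + (Complex.I * (η k : ℂ)) • valL M u := rfl

lemma coeFn_dShiftL (Λ : Matrix (Fin M) (Fin d) ℝ) (η : Fin d → ℝ) (k : Fin d) (u : HS M) :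
    dShiftL Λ η k u =ᵐ[volume.restrict (cell M)] dShift Λ η u k := by
  rw [dShiftL_apply]
  filter_upwards [Lp.coeFn_add (dLamL Λ k u) ((Complex.I * (η k : ℂ)) • valL M u),
    Lp.coeFn_smul (Complex.I * (η k : ℂ)) (valL M u), coeFn_dLamL Λ k u] with y h1 h2 h3
  rw [h1, Pi.add_apply, h2, h3]
  rfl

/-- The Dirichlet form `∑ j, ⟪∂_j v, ∂_j u⟫`. -/
def dirichletForm (u v : HS M) : ℂ := ∑ j, inner ℂ (dyL j v) (dyL j u)

lemma dirichletForm_eq_integral (u v : HS M) :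
    dirichletForm u v = ∫ y in cell M, ∑ j, dy j u y * conj (dy j v y) := by
  simp only [← coe_dyL]
  rw [integral_finsetSum _ fun j _ => integrable_mul_conj (dyL j u) (dyL j v)]
  exact Finset.sum_congr rfl fun j _ => inner_L2_eq _ _

lemma dirichletForm_conj (u v : HS M) : conj (dirichletForm u v) = dirichletForm v u := by
  simp only [dirichletForm, map_sum, inner_conj_symm]

lemma dirichletForm_self (u : HS M) :
    dirichletForm u u = ((‖u‖ ^ 2 - ‖valL M u‖ ^ 2 : ℝ) : ℂ) := by
  rw [norm_sq_H1, add_sub_cancel_left, dirichletForm, Complex.ofReal_sum]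
  exact Finset.sum_congr rfl fun j _ => inner_self_eq_ofReal _

lemma coeffForm_congr {b : Fin d → Fin d → C(Fin M → ℝ, ℝ)} {f g : Fin d → L2 M}
    {f' g' : Fin d → (Fin M → ℝ) → ℂ} (hf : ∀ k, f k =ᵐ[volume.restrict (cell M)] f' k)
    (hg : ∀ k, g k =ᵐ[volume.restrict (cell M)] g' k) :
    ∫ y in cell M, ∑ k, ∑ l, (b k l y : ℂ) * f' l y * conj (g' k y) = coeffForm b f g := by
  rw [coeffForm_eq_integral]
  refine integral_congr_ae ?_
  filter_upwards [ae_all_iff.2 hf, ae_all_iff.2 hg] with y h1 h2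
  simp only [h1, h2]

end Operators

/-! ### The operator of the Bloch form and the cell problem -/

section BlochOperator

open ContinuousLinearMap

variable {d M : ℕ}

/-- The operator on `H¹_♯(Q)` that represents `δ ∫ ∇u · conj ∇v`. -/
def dirichletOp (M : ℕ) (δ : ℝ) : HS M →L[ℂ] HS M :=
  (δ : ℂ) • ∑ j : Fin M, adjoint (dyL j) ∘L dyL j

lemma inner_dirichletOp (δ : ℝ) (u v : HS M) :
    inner ℂ v (dirichletOp M δ u) = (δ : ℂ) * dirichletForm u v := by
  simp only [dirichletOp, _root_.smul_apply, _root_.sum_apply, inner_smul_right, inner_sum,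
    ContinuousLinearMap.comp_apply, adjoint_inner_right, dirichletForm]

/-- The operator on `H¹_♯(Q)` that represents the form `a^δ[η]`. -/
abbrev blochOp (b : Fin d → Fin d → C(Fin M → ℝ, ℝ)) (Λ : Matrix (Fin M) (Fin d) ℝ) (δ : ℝ)
    (η : Fin d → ℝ) : HS M →L[ℂ] HS M :=
  formOp (dLamL Λ) (fun k l => mulL (b k l)) (valL M) (dirichletOp M δ) η

variable (b : Fin d → Fin d → C(Fin M → ℝ, ℝ)) (Λ : Matrix (Fin M) (Fin d) ℝ) (δ : ℝ)

lemma inner_blochOp (η : Fin d → ℝ) (u v : HS M) :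
    inner ℂ v (blochOp b Λ δ η u) =
      coeffForm b (fun l => dShiftL Λ η l u) (fun k => dShiftL Λ η k v) +
        (δ : ℂ) * dirichletForm u v := by
  rw [inner_formOp, inner_dirichletOp]
  rfl

lemma inner_blochOp_zero (u v : HS M) :
    inner ℂ v (blochOp b Λ δ 0 u) =
      coeffForm b (fun l => dLamL Λ l u) (fun k => dLamL Λ k v) + (δ : ℂ) * dirichletForm u v := by
  rw [inner_blochOp]
  simp only [dShiftL_apply, Pi.zero_apply, Complex.ofReal_zero, mul_zero, zero_smul, add_zero]

lemma blochOp_zero_oneH1 : blochOp b Λ δ 0 (oneH1 M) = 0 := by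
  refine ext_inner_left ℂ fun v => ?_
  rw [inner_blochOp_zero]
  simp [coeffForm, dirichletForm, dLamL_oneH1, dyL_oneH1]

variable {b}

lemma blochOp_symm (hb : ∀ k l, b k l = b l k) (η : Fin d → ℝ) (u v : HS M) :
    inner ℂ (blochOp b Λ δ η u) v = inner ℂ u (blochOp b Λ δ η v) := by
  rw [← inner_conj_symm, inner_blochOp, inner_blochOp, map_add, map_mul, Complex.conj_ofReal,
    coeffForm_conj hb, dirichletForm_conj]

/-- The coefficient part is nonnegative and is dropped; the regularization alone gives the bound,
uniformly in η. -/
lemma blochOp_lower_bound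
    (hb : ∀ (y : Fin M → ℝ) (v : Fin d → ℝ), 0 ≤ ∑ k, ∑ l, b k l y * v l * v k)
    (η : Fin d → ℝ) (u : HS M) :
    δ * (‖u‖ ^ 2 - ‖valL M u‖ ^ 2) ≤ (inner ℂ u (blochOp b Λ δ η u)).re := by
  rw [inner_blochOp, dirichletForm_self, ← Complex.ofReal_mul, Complex.add_re, Complex.ofReal_re]
  exact le_add_of_nonneg_left (coeffForm_nonneg hb _)

lemma norm_valL_le (u : HS M) : ‖valL M u‖ ≤ ‖u‖ := by
  refine abs_le_of_sq_le_sq' ?_ (norm_nonneg _) |>.2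
  rw [norm_sq_H1]
  exact le_add_of_nonneg_right (Finset.sum_nonneg fun j _ => by positivity)

variable {B : (Fin M → ℝ) → Matrix (Fin d) (Fin d) ℝ} {Λ δ}

lemma blochForm_eq_inner (hB : ∀ k l y, b k l y = B y k l) (η : Fin d → ℝ) (u v : HS M) :
    blochForm B Λ δ η u v = inner ℂ v (blochOp b Λ δ η u) := by
  rw [inner_blochOp, dirichletForm_eq_integral,
    ← coeffForm_congr (fun k => coeFn_dShiftL Λ η k u) (fun k => coeFn_dShiftL Λ η k v)]
  simp only [hB]
  rfl

lemma isBlochEigenfunction_iff (hB : ∀ k l y, b k l y = B y k l) {η : Fin d → ℝ} {μ : ℝ}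
    {φ : HS M} : IsBlochEigenfunction B Λ δ η μ φ ↔
      φ ≠ 0 ∧ blochOp b Λ δ η φ = (μ : ℂ) • adjoint (valL M) (valL M φ) := by
  refine and_congr Iff.rfl ?_
  have h : ∀ v : HS M, (μ : ℂ) * ∫ y in cell M, val φ y * conj (val v y) =
      inner ℂ v ((μ : ℂ) • adjoint (valL M) (valL M φ)) := fun v => by
    rw [inner_smul_right, adjoint_inner_right, inner_L2_eq]
    rfl
  exact ⟨fun h' => ext_inner_left ℂ fun v =>
      (blochForm_eq_inner hB η φ v).symm.trans ((h' v).trans (h v)),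
    fun h' v => (blochForm_eq_inner hB η φ v).trans
      ((congrArg (fun w : HS M => inner ℂ (v : HS M) w) h').trans (h v).symm)⟩

/-- The source `r_l` of the cell problem: `⟪v, r_l⟫ = ∫ ∑ k, b_{kl} conj (D_k v)`. -/
abbrev source (b : Fin d → Fin d → C(Fin M → ℝ, ℝ)) (Λ : Matrix (Fin M) (Fin d) ℝ) (l : Fin d) :
    HS M :=
  cellSource (dLamL Λ) (fun k l => mulL (b k l)) (valL M) (oneH1 M) l

lemma inner_source (l : Fin d) (v : HS M) :
    inner ℂ v (source b Λ l) = ∑ k, inner ℂ (dLamL Λ k v) (mulL (b k l) (oneL2 M)) := by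
  simp only [cellSource, inner_sum, adjoint_inner_right, valL_oneH1]

lemma isCellSolution_iff (hB : ∀ k l y, b k l y = B y k l) {l : Fin d} {ψ : HS M} :
    IsCellSolution B Λ δ l ψ ↔ blochOp b Λ δ 0 ψ = -source b Λ l := by
  have h1 : ∀ v : HS M,
      (∫ y in cell M, ∑ k, ∑ m, (B y k m : ℂ) * dLam Λ ψ m y * conj (dLam Λ v k y)) +
        (δ : ℂ) * ∫ y in cell M, ∑ j, dy j ψ y * conj (dy j v y) =
      inner ℂ v (blochOp b Λ δ 0 ψ) := fun v => by
    rw [inner_blochOp_zero, dirichletForm_eq_integral,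
      ← coeffForm_congr (fun k => coeFn_dLamL Λ k ψ) (fun k => coeFn_dLamL Λ k v)]
    simp only [hB]
  have h2 : ∀ v : HS M, -∫ y in cell M, ∑ k, (B y k l : ℂ) * conj (dLam Λ v k y) =
      inner ℂ v (-source b Λ l) := fun v => by
    rw [inner_neg_right, inner_source]
    simp only [inner_mulL]
    rw [← integral_finsetSum _ fun k _ => integrable_mulL _ _ _]
    congr 1
    refine integral_congr_ae ?_
    filter_upwards [coeFn_oneL2 M, ae_all_iff.2 fun k => coeFn_dLamL Λ k v] with y h1 h2
    simp only [h1, h2, hB, mul_one]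
  exact ⟨fun h => ext_inner_left ℂ fun v => (h1 v).symm.trans ((h v).trans (h2 v)),
    fun h v => (h1 v).trans
      ((congrArg (fun w : HS M => inner ℂ (v : HS M) w) h).trans (h2 v).symm)⟩

/-- The mean of `b_{kl} + e_k · B D ψ` without its normalisation. -/
def homSum (b : Fin d → Fin d → C(Fin M → ℝ, ℝ)) (Λ : Matrix (Fin M) (Fin d) ℝ) (k l : Fin d)
    (ψ : HS M) : ℂ :=
  inner ℂ (oneL2 M) (mulL (b k l) (oneL2 M)) +
    ∑ n, inner ℂ (oneL2 M) (mulL (b k n) (dLamL Λ n ψ))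

lemma approxHom_eq (hB : ∀ k l y, b k l y = B y k l) (k l : Fin d) (ψ : HS M) :
    approxHom B Λ k l ψ = (((‖oneL2 M‖ ^ 2)⁻¹ : ℝ) : ℂ) * homSum b Λ k l ψ := by
  change (⨍ y in cell M, ((B y k l : ℂ) + ∑ m, (B y k m : ℂ) * dLam Λ ψ m y)) = _
  rw [setAverage_eq, norm_sq_oneL2, Complex.real_smul, homSum]
  congr 1
  simp only [inner_mulL]
  rw [← integral_finsetSum _ fun n _ => integrable_mulL _ _ _,
    ← integral_add (integrable_mulL _ _ _)
      (integrable_finsetSum _ fun n _ => integrable_mulL _ _ _)]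
  refine integral_congr_ae ?_
  filter_upwards [coeFn_oneL2 M, ae_all_iff.2 fun n => coeFn_dLamL Λ n ψ] with y h1 h2
  simp only [h1, h2, hB, mul_one, map_one]

end BlochOperator

/-! ### Complex conjugation: real cell solutions, symmetry of the homogenized matrix -/

section Conjugation

variable {d M : ℕ}

lemma inner_star_star (f g : L2 M) : inner ℂ (star f) (star g) = conj (inner ℂ f g) := by
  rw [inner_L2_eq, inner_L2_eq, ← integral_conj]
  refine integral_congr_ae ?_
  filter_upwards [Lp.coeFn_star f, Lp.coeFn_star g] with y h1 h2
  simp [h1, h2]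

lemma mulL_star (b : C(Fin M → ℝ, ℝ)) (f : L2 M) : mulL b (star f) = star (mulL b f) := by
  refine Lp.ext ?_
  filter_upwards [coeFn_mulL b f, coeFn_mulL b (star f), Lp.coeFn_star f,
    Lp.coeFn_star (mulL b f)] with y h1 h2 h3 h4
  simp [h1, h2, h3, h4]

lemma star_oneL2 (M : ℕ) : star (oneL2 M) = oneL2 M := by
  refine Lp.ext ?_
  filter_upwards [coeFn_oneL2 M, Lp.coeFn_star (oneL2 M)] with y h1 h2
  simp [h1, h2]

lemma fourierInt_star (f : L2 M) (n : Fin M → ℤ) :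
    fourierInt (star f) n = conj (fourierInt f (-n)) := by
  rw [fourierInt, fourierInt, ← integral_conj]
  refine integral_congr_ae ?_
  filter_upwards [Lp.coeFn_star f] with y hy
  rw [hy, Pi.star_apply, map_mul, expNeg, expNeg, ← Complex.exp_conj]
  simp

/-- Complex conjugation on `H¹_♯(Q)`. -/
def starH1 (u : HS M) : HS M := show H1 M from
  ⟨WithLp.toLp 2 (star (valL M u), WithLp.toLp 2 fun j => star (dyL j u)), by
    intro j n
    change fourierInt (star (dyL j u)) n = _ * fourierInt (star (valL M u)) n
    rw [fourierInt_star, fourierInt_star, fourierInt_dyL]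
    simp⟩

lemma valL_starH1 (u : HS M) : valL M (starH1 u) = star (valL M u) := rfl

lemma dyL_starH1 (j : Fin M) (u : HS M) : dyL j (starH1 u) = star (dyL j u) := rfl

lemma starH1_starH1 (u : HS M) : starH1 (starH1 u) = u :=
  H1_ext (by simp [valL_starH1]) fun j => by simp [dyL_starH1]

lemma dLamL_starH1 (Λ : Matrix (Fin M) (Fin d) ℝ) (k : Fin d) (u : HS M) :
    dLamL Λ k (starH1 u) = star (dLamL Λ k u) := by
  refine Lp.ext ?_
  filter_upwards [coeFn_dLamL Λ k u, coeFn_dLamL Λ k (starH1 u), Lp.coeFn_star (dLamL Λ k u),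
    ae_all_iff.2 fun j => Lp.coeFn_star (dyL j u)] with y h1 h2 h3 h4
  rw [h2, h3, Pi.star_apply, h1]
  change ∑ j, (Λ j k : ℂ) * dy j (starH1 u) y = star (∑ j, (Λ j k : ℂ) * dy j u y)
  rw [star_sum]
  refine Finset.sum_congr rfl fun j _ => ?_
  have h5 : dy j (starH1 u) y = star (dy j u y) := h4 j
  rw [h5]
  simp

variable {b : Fin d → Fin d → C(Fin M → ℝ, ℝ)} {Λ : Matrix (Fin M) (Fin d) ℝ} {δ : ℝ}

/-- At η = 0 all coefficients of the form are real; the terms iη would break this. -/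
lemma inner_blochOp_zero_starH1 (u v : HS M) :
    inner ℂ (starH1 v) (blochOp b Λ δ 0 (starH1 u)) = conj (inner ℂ v (blochOp b Λ δ 0 u)) := by
  simp only [inner_blochOp_zero, coeffForm, dirichletForm, dLamL_starH1, dyL_starH1, mulL_star,
    inner_star_star, map_add, map_sum, map_mul, Complex.conj_ofReal]

lemma inner_starH1_source (l : Fin d) (v : HS M) :
    inner ℂ (starH1 v) (source b Λ l) = conj (inner ℂ v (source b Λ l)) := by
  simp only [inner_source, map_sum, dLamL_starH1]
  refine Finset.sum_congr rfl fun k _ => ?_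
  rw [← inner_star_star, ← mulL_star, star_oneL2]

lemma blochOp_zero_starH1 {l : Fin d} {ψ : HS M} (h : blochOp b Λ δ 0 ψ = -source b Λ l) :
    blochOp b Λ δ 0 (starH1 ψ) = -source b Λ l := by
  refine ext_inner_left ℂ fun v => ?_
  have h1 := inner_blochOp_zero_starH1 (b := b) (Λ := Λ) (δ := δ) ψ (starH1 v)
  rw [starH1_starH1] at h1
  rw [h1, h, inner_neg_right, inner_neg_right, map_neg, inner_starH1_source, Complex.conj_conj]

lemma star_half_add_star (f : L2 M) :
    star ((1 / 2 : ℂ) • (f + star f)) = (1 / 2 : ℂ) • (f + star f) := by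
  refine Lp.ext ?_
  filter_upwards [Lp.coeFn_star ((1 / 2 : ℂ) • (f + star f)),
    Lp.coeFn_smul (1 / 2 : ℂ) (f + star f),
    Lp.coeFn_add f (star f), Lp.coeFn_star f] with y h1 h2 h3 h4
  rw [h1, Pi.star_apply, h2, Pi.smul_apply, h3, Pi.add_apply, h4, Pi.star_apply, star_smul,
    star_add, star_star, add_comm (star _)]
  simp

/-- The conjugate of a solution is again a solution, so the average of the two is a real one. -/
lemma exists_real_cell_solution {l : Fin d} {ψ : HS M} (h : blochOp b Λ δ 0 ψ = -source b Λ l) :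
    ∃ ψ' : HS M, blochOp b Λ δ 0 ψ' = -source b Λ l ∧ starH1 ψ' = ψ' := by
  refine ⟨(1 / 2 : ℂ) • (ψ + starH1 ψ), ?_, H1_ext ?_ fun j => ?_⟩
  · rw [map_smul, map_add, blochOp_zero_starH1 h, h, ← two_smul ℂ, smul_smul]
    norm_num
  · rw [valL_starH1, map_smul, map_add, valL_starH1, star_half_add_star]
  · rw [dyL_starH1, map_smul, map_add, dyL_starH1, star_half_add_star]

lemma val_im_eq_zero {ψ : HS M} (h : starH1 ψ = ψ) :
    ∀ᵐ y ∂volume.restrict (cell M), (val ψ y).im = 0 := by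
  have h1 := valL_starH1 ψ
  rw [h] at h1
  have h2 := Lp.coeFn_star (valL M ψ)
  rw [← h1] at h2
  filter_upwards [h2] with y hy
  exact Complex.conj_eq_iff_im.1 hy.symm

/-- Symmetry of b turns the corrector term into a pairing of ψ with the k-th source, the form in
which symmetry and reality become visible. -/
lemma homSum_eq (hb : ∀ k l, b k l = b l k) (k l : Fin d) (ψ : HS M) :
    homSum b Λ k l ψ = inner ℂ (oneL2 M) (mulL (b k l) (oneL2 M)) +
      conj (inner ℂ ψ (source b Λ k)) := by
  rw [homSum, inner_source, map_sum]
  simp only [inner_mulL_conj]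
  simp only [hb]

/-- The approximate homogenized matrix of real cell solutions is real. -/
lemma homSum_conj (hb : ∀ k l, b k l = b l k) {k l : Fin d} {ψ : HS M} (h : starH1 ψ = ψ) :
    conj (homSum b Λ k l ψ) = homSum b Λ k l ψ := by
  have h1 := inner_starH1_source (b := b) (Λ := Λ) k ψ
  rw [h] at h1
  rw [homSum_eq hb, map_add, inner_mulL_conj, ← h1, h1]
  rw [← h1, ← h1]

/-- The approximate homogenized matrix of real cell solutions is symmetric. -/
lemma homSum_symm (hb : ∀ k l, b k l = b l k) {k l : Fin d} {ψk ψl : HS M}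
    (hk : blochOp b Λ δ 0 ψk = -source b Λ k) (hl : blochOp b Λ δ 0 ψl = -source b Λ l)
    (hk' : starH1 ψk = ψk) : homSum b Λ k l ψl = homSum b Λ l k ψk := by
  rw [homSum_eq hb, homSum_eq hb, hb l k]
  congr 1
  have h1 := inner_starH1_source (b := b) (Λ := Λ) l ψk
  rw [hk'] at h1
  -- Reality of ψk removes one conjugation; after each source is replaced by minus the operator
  -- applied to its cell solution, the claim is the symmetry of that operator.
  rw [← h1, inner_conj_symm, ← neg_inj, ← inner_neg_left, ← inner_neg_right, ← hk, ← hl,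
    blochOp_symm Λ δ hb]

end Conjugation

/-! ### The Bloch ground state, its derivative and the derivative of the flux -/

section Assembly

open ContinuousLinearMap

variable {d M : ℕ} {A : (Fin d → ℝ) → Matrix (Fin d) (Fin d) ℝ}
  {B : (Fin M → ℝ) → Matrix (Fin d) (Fin d) ℝ} {Λ : Matrix (Fin M) (Fin d) ℝ}

/-- The entries of `B` as continuous functions. -/
def IsQuasiperiodicCoeff.entry (h : IsQuasiperiodicCoeff A B Λ) (k l : Fin d) :
    C(Fin M → ℝ, ℝ) :=
  ⟨fun y => B y k l, (h.lift_smooth k l).continuous⟩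

lemma IsQuasiperiodicCoeff.entry_symm (h : IsQuasiperiodicCoeff A B Λ) (k l : Fin d) :
    h.entry k l = h.entry l k :=
  ContinuousMap.ext fun y => h.lift_symm y k l

lemma IsQuasiperiodicCoeff.entry_nonneg (h : IsQuasiperiodicCoeff A B Λ) (y : Fin M → ℝ)
    (v : Fin d → ℝ) : 0 ≤ ∑ k, ∑ l, h.entry k l y * v l * v k := by
  refine (h.lift_nonneg y v).trans_eq ?_
  simp only [dotProduct, Matrix.mulVec, Finset.sum_mul]
  rfl

variable {b : Fin d → Fin d → C(Fin M → ℝ, ℝ)} {δ : ℝ}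

/-- The null space of the unperturbed operator consists of the constants. -/
lemma eq_smul_oneH1 (hδ : 0 < δ)
    (hb : ∀ (y : Fin M → ℝ) (v : Fin d → ℝ), 0 ≤ ∑ k, ∑ l, b k l y * v l * v k) {u : HS M}
    (hu : blochOp b Λ δ 0 u = 0) : ∃ c : ℂ, u = c • oneH1 M :=
  eq_smul_of_apply_eq_zero (T := blochOp b Λ δ 0) (J := valL M) (e := oneH1 M) hδ
    (blochOp_lower_bound Λ δ hb 0) poincare (blochOp_zero_oneH1 b Λ δ) (oneL2_ne_zero M) hu

lemma val_ae_eq_of_eq_smul {u : HS M} {c : ℂ} (h : u = c • oneH1 M) :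
    ∀ᵐ y ∂volume.restrict (cell M), valL M u y = c := by
  have h1 : valL M u = c • oneL2 M := by rw [h, map_smul, valL_oneH1]
  rw [h1]
  filter_upwards [Lp.coeFn_smul c (oneL2 M), coeFn_oneL2 M] with y h2 h3
  rw [h2, Pi.smul_apply, h3, smul_eq_mul, mul_one]

lemma exists_ground_state (hδ : 0 < δ) (hsymm : ∀ k l, b k l = b l k)
    (hb : ∀ (y : Fin M → ℝ) (v : Fin d → ℝ), 0 ≤ ∑ k, ∑ l, b k l y * v l * v k)
    (hB : ∀ k l y, b k l y = B y k l) :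
    ∃ φ : (Fin d → ℝ) → HS M, AnalyticAt ℝ φ 0 ∧ AnalyticAt ℝ (blochEigenvalue₁ B Λ δ) 0 ∧
      blochEigenvalue₁ B Λ δ 0 = 0 ∧ φ 0 = oneH1 M ∧ ∀ᶠ η in 𝓝 (0 : Fin d → ℝ),
        IsLeast (blochEigenvalues B Λ δ η) (blochEigenvalue₁ B Λ δ η) ∧ φ η ≠ 0 ∧
        inner ℂ (oneL2 M) (valL M (φ η)) = ((‖oneL2 M‖ ^ 2 : ℝ) : ℂ) ∧
        blochOp b Λ δ η (φ η) =
          (blochEigenvalue₁ B Λ δ η : ℂ) • adjoint (valL M) (valL M (φ η)) := by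
  obtain ⟨s, φ, hs, hφ, hs0, hφ0, hev⟩ := exists_analytic_ground_state
    (T := fun η => blochOp b Λ δ η) (J := valL M) (e := oneH1 M) hδ (analyticAt_formOp _ _ _ _ 0)
    (blochOp_symm Λ δ hsymm) norm_valL_le (blochOp_lower_bound Λ δ hb) poincare
    (blochOp_zero_oneH1 b Λ δ) (oneL2_ne_zero M)
  have hleast : ∀ᶠ η in 𝓝 (0 : Fin d → ℝ), IsLeast (blochEigenvalues B Λ δ η) (s η) := by
    filter_upwards [hev] with η hη
    refine ⟨⟨φ η, (isBlochEigenfunction_iff hB).2 ⟨hη.1, hη.2.2.1⟩⟩, ?_⟩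
    rintro μ ⟨u, hu⟩
    obtain ⟨hu0, hu⟩ := (isBlochEigenfunction_iff (φ := u) hB).1 hu
    exact hη.2.2.2 μ u hu0 hu
  have heq : ∀ᶠ η in 𝓝 (0 : Fin d → ℝ), s η = blochEigenvalue₁ B Λ δ η :=
    hleast.mono fun η h => h.csInf_eq.symm
  refine ⟨φ, hφ, hs.congr heq, heq.self_of_nhds.symm.trans hs0, hφ0, ?_⟩
  filter_upwards [hev, hleast, heq] with η h1 h2 h3
  rw [← h3]
  exact ⟨h2, h1.1, h1.2.1, h1.2.2.1⟩

lemma dLamL_eq_of_sub_eq_smul {u v : HS M} {a c : ℂ} (h : u - a • v = c • oneH1 M) (n : Fin d) :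
    dLamL Λ n u = a • dLamL Λ n v := by
  have h1 := congrArg (dLamL Λ n) h
  rw [map_sub, map_smul, map_smul, dLamL_oneH1, smul_zero, sub_eq_zero] at h1
  exact h1

/-- Two cell solutions differ by a constant, which D annihilates. -/
lemma homSum_eq_of_cell (hδ : 0 < δ)
    (hb : ∀ (y : Fin M → ℝ) (v : Fin d → ℝ), 0 ≤ ∑ k, ∑ l, b k l y * v l * v k) {k l : Fin d}
    {ψ ψ' : HS M} (h : blochOp b Λ δ 0 ψ = -source b Λ l)
    (h' : blochOp b Λ δ 0 ψ' = -source b Λ l) : homSum b Λ k l ψ = homSum b Λ k l ψ' := by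
  obtain ⟨c, hc⟩ := eq_smul_oneH1 hδ hb (u := ψ - (1 : ℂ) • ψ') (by
    rw [map_sub, map_smul, one_smul, h, h', sub_self])
  simp only [homSum, dLamL_eq_of_sub_eq_smul hc, one_smul]

lemma blochEigenvalue₁_eq_sum {φ : (Fin d → ℝ) → HS M} {η : Fin d → ℝ}
    (h1 : inner ℂ (oneL2 M) (valL M (φ η)) = ((‖oneL2 M‖ ^ 2 : ℝ) : ℂ)) {s : ℝ}
    (h2 : blochOp b Λ δ η (φ η) = (s : ℂ) • adjoint (valL M) (valL M (φ η))) :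
    s = ∑ k, η k * ((‖oneL2 M‖ ^ 2)⁻¹ *
      (meanFlux (dLamL Λ) (fun k l => mulL (b k l)) (valL M) (oneH1 M) k η (φ η)).re) := by
  have hV : ‖oneL2 M‖ ^ 2 ≠ 0 := pow_ne_zero _ (norm_ne_zero_iff.2 (oneL2_ne_zero M))
  have h3 := eigenvalue_mul_eq_sum_meanFlux (J := valL M) (e := oneH1 M) (dLamL_oneH1 Λ)
    (fun u => by rw [inner_dirichletOp]; simp [dirichletForm, dyL_oneH1]) h1 h2
  rw [valL_oneH1] at h3
  rw [← mul_inv_cancel_right₀ hV s, h3, Finset.sum_mul]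
  exact Finset.sum_congr rfl fun k _ => by ring

/-- The derivative of a family of first eigenfunctions, in terms of a cell solution. -/
lemma fderiv_eigenfunction_sub_const (hδ : 0 < δ)
    (hb : ∀ (y : Fin M → ℝ) (v : Fin d → ℝ), 0 ≤ ∑ k, ∑ l, b k l y * v l * v k)
    {s : (Fin d → ℝ) → ℝ} (hs : DifferentiableAt ℝ s 0) (hs0 : s 0 = 0) {l : Fin d}
    (hsl : fderiv ℝ s 0 (Pi.single l 1) = 0) {φ : (Fin d → ℝ) → HS M}
    (hφ : DifferentiableAt ℝ φ 0) (hev : ∀ᶠ η in 𝓝 (0 : Fin d → ℝ),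
      blochOp b Λ δ η (φ η) = (s η : ℂ) • adjoint (valL M) (valL M (φ η))) {ψ : HS M}
    (hψ : blochOp b Λ δ 0 ψ = -source b Λ l) :
    ∃ c : ℂ, ∀ᵐ y ∂volume.restrict (cell M), valL M (fderiv ℝ φ 0 (Pi.single l 1)) y -
      Complex.I * valL M (φ 0) y * valL M ψ y = c := by
  obtain ⟨c, hc⟩ := eq_smul_oneH1 hδ hb (Λ := Λ) (u := φ 0) (by
    have := hev.self_of_nhds
    rwa [hs0, Complex.ofReal_zero, zero_smul] at this)
  have hd : blochOp b Λ δ 0 (fderiv ℝ φ 0 (Pi.single l 1)) = -(Complex.I * c) • source b Λ l :=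
    formOp_fderiv_eigenvector (dLamL_oneH1 Λ) hs hs0 hsl hφ hc hev
  obtain ⟨c', hc'⟩ := eq_smul_oneH1 hδ hb (Λ := Λ)
    (u := fderiv ℝ φ 0 (Pi.single l 1) - (Complex.I * c) • ψ) (by
      rw [map_sub, map_smul, hψ, hd]
      simp)
  refine ⟨c', ?_⟩
  have h1 := val_ae_eq_of_eq_smul hc'
  have h2 := val_ae_eq_of_eq_smul hc
  rw [map_sub, map_smul] at h1
  filter_upwards [h1, h2,
    Lp.coeFn_sub (valL M (fderiv ℝ φ 0 (Pi.single l 1))) ((Complex.I * c) • valL M ψ),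
    Lp.coeFn_smul (Complex.I * c) (valL M ψ)] with y h1 h2 h3 h4
  rw [← h1, h3, Pi.sub_apply, h4, Pi.smul_apply, smul_eq_mul, ← h2]

lemma analyticAt_re_meanFlux {φ : (Fin d → ℝ) → HS M} (hφ : AnalyticAt ℝ φ 0) (k : Fin d) :
    AnalyticAt ℝ (fun η =>
      (meanFlux (dLamL Λ) (fun k l => mulL (b k l)) (valL M) (oneH1 M) k η (φ η)).re) 0 :=
  analyticAt_re_meanFlux_of (D := dLamL Λ) (m := fun k l => mulL (b k l)) (J := valL M)
    (oneH1 M) k hφ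

lemma pderiv_meanFlux (hδ : 0 < δ)
    (hb : ∀ (y : Fin M → ℝ) (v : Fin d → ℝ), 0 ≤ ∑ k, ∑ l, b k l y * v l * v k)
    {φ : (Fin d → ℝ) → HS M} (hφ : AnalyticAt ℝ φ 0) (hφ0 : φ 0 = oneH1 M) {i : Fin d}
    (hd : blochOp b Λ δ 0 (fderiv ℝ φ 0 (Pi.single i 1)) = -Complex.I • source b Λ i)
    {ψ : HS M} (hψ : blochOp b Λ δ 0 ψ = -source b Λ i) (j : Fin d) :
    pderiv i (fun η => (‖oneL2 M‖ ^ 2)⁻¹ *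
      (meanFlux (dLamL Λ) (fun k l => mulL (b k l)) (valL M) (oneH1 M) j η (φ η)).re) 0 =
      (‖oneL2 M‖ ^ 2)⁻¹ * (homSum b Λ j i ψ).re := by
  -- The derivative of φ is iψ up to a constant, so D of it is i Dψ; the factor -i in the flux then
  -- restores the integrand of the homogenized matrix.
  obtain ⟨c, hc⟩ := eq_smul_oneH1 hδ hb (Λ := Λ)
    (u := fderiv ℝ φ 0 (Pi.single i 1) - Complex.I • ψ) (by
      rw [map_sub, map_smul, hψ, hd]; simp)
  rw [pderiv, fderiv_const_mul (analyticAt_re_meanFlux hφ j).differentiableAt]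
  rw [_root_.smul_apply, fderiv_meanFlux j i hφ.differentiableAt hφ0, valL_oneH1, smul_eq_mul]
  simp only [dLamL_eq_of_sub_eq_smul hc, map_smul, inner_smul_right, ← Finset.mul_sum]
  rw [← mul_add, ← mul_assoc, neg_mul, Complex.I_mul_I, neg_neg, one_mul, homSum, add_comm]

end Assembly

end QPBloch

end

theorem theorem6p1 {d M : ℕ} (hdM : d < M)
    (A : (Fin d → ℝ) → Matrix (Fin d) (Fin d) ℝ) (B : (Fin M → ℝ) → Matrix (Fin d) (Fin d) ℝ)
    (Λ : Matrix (Fin M) (Fin d) ℝ) (hAB : IsQuasiperiodicCoeff A B Λ)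
    (δ : ℝ) (hδ₀ : 0 < δ) (hδ₁ : δ < 1) :
    -- the objects of the statement exist and are regular near `η = 0`
    (∀ᶠ η in 𝓝 (0 : Fin d → ℝ),
      IsLeast (blochEigenvalues B Λ δ η) (blochEigenvalue₁ B Λ δ η)) ∧
    AnalyticAt ℝ (blochEigenvalue₁ B Λ δ) 0 ∧
    (∃ φ : (Fin d → ℝ) → H1 M, AnalyticAt ℝ φ 0 ∧
      ∀ᶠ η in 𝓝 (0 : Fin d → ℝ),
        IsBlochEigenfunction B Λ δ η (blochEigenvalue₁ B Λ δ η) (φ η)) ∧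
    (∀ l : Fin d, ∃ ψ : H1 M, IsCellSolution B Λ δ l ψ ∧
      ∀ᵐ y ∂volume.restrict (cell M), (val ψ y).im = 0) ∧
    -- the first eigenvalue at `0`
    blochEigenvalue₁ B Λ δ 0 = 0 ∧
    -- `0` is a critical point
    (∀ l : Fin d, pderiv l (blochEigenvalue₁ B Λ δ) 0 = 0) ∧
    -- the derivatives of the first eigenfunction
    (∀ φ : (Fin d → ℝ) → H1 M, DifferentiableAt ℝ φ 0 →
      (∀ᶠ η in 𝓝 (0 : Fin d → ℝ),
        IsBlochEigenfunction B Λ δ η (blochEigenvalue₁ B Λ δ η) (φ η)) →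
      ∀ (l : Fin d) (ψ : H1 M), IsCellSolution B Λ δ l ψ →
        ∃ c : ℂ, ∀ᵐ y ∂volume.restrict (cell M),
          val (pderiv l φ 0) y - Complex.I * val (φ 0) y * val ψ y = c) ∧
    -- the Hessian
    (∀ (k l : Fin d) (ψ : H1 M), IsCellSolution B Λ δ l ψ →
      ((1 / 2 * pderiv k (pderiv l (blochEigenvalue₁ B Λ δ)) 0 : ℝ) : ℂ) =
        approxHom B Λ k l ψ) := by
  obtain ⟨b, hB, hsymm, hb⟩ : ∃ b : Fin d → Fin d → C(Fin M → ℝ, ℝ),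
      (∀ k l y, b k l y = B y k l) ∧ (∀ k l, b k l = b l k) ∧
      ∀ (y : Fin M → ℝ) (v : Fin d → ℝ), 0 ≤ ∑ k, ∑ l, b k l y * v l * v k :=
    ⟨hAB.entry, fun _ _ _ => rfl, hAB.entry_symm, hAB.entry_nonneg⟩
  obtain ⟨φ, hφ, hlam, hlam0, hφ0, hev⟩ := exists_ground_state (Λ := Λ) hδ₀ hsymm hb hB
  obtain ⟨hcrit, hhess⟩ := pderiv_of_eq_sum_mul
    (h := fun k η => (‖oneL2 M‖ ^ 2)⁻¹ *
      (meanFlux (dLamL Λ) (fun k l => mulL (b k l)) (valL M) (oneH1 M) k η (φ η)).re)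
    (fun k => analyticAt_const.mul (analyticAt_re_meanFlux hφ k))
    (fun k => by
      simp only [meanFlux, hφ0, dLamL_oneH1, Pi.zero_apply, Complex.ofReal_zero, mul_zero,
        zero_smul, add_zero, map_zero, inner_zero_right, Finset.sum_const_zero, Complex.zero_re])
    (hev.mono fun η hη => blochEigenvalue₁_eq_sum hη.2.2.1 hη.2.2.2)
  have hderiv : ∀ l, blochOp b Λ δ 0 (fderiv ℝ φ 0 (Pi.single l 1)) =
      -Complex.I • source b Λ l := fun l => by
    have h1 := formOp_fderiv_eigenvector (c := 1) (dLamL_oneH1 Λ) hlam.differentiableAt hlam0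
      (hcrit l) hφ.differentiableAt (by rw [hφ0, one_smul]) (hev.mono fun η hη => hη.2.2.2)
    rwa [mul_one] at h1
  have hcell : ∀ l, ∃ ψ : HS M, blochOp b Λ δ 0 ψ = -source b Λ l ∧ starH1 ψ = ψ := fun l => by
    -- The derivative of the eigenvector solves the cell problem with source multiplied by i; the
    -- factor -i corrects this, so solvability needs no separate argument.
    refine exists_real_cell_solution
      (ψ := (-Complex.I) • fderiv ℝ φ 0 (Pi.single l 1)) ?_
    rw [map_smul, hderiv, smul_smul, neg_mul_neg, Complex.I_mul_I, neg_one_smul]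
  refine ⟨hev.mono fun η hη => hη.1, hlam, ⟨φ, hφ, hev.mono fun η hη =>
    (isBlochEigenfunction_iff hB).2 ⟨hη.2.1, hη.2.2.2⟩⟩, fun l => ?_, hlam0, hcrit, ?_, ?_⟩
  · obtain ⟨ψ, hψ, hψ'⟩ := hcell l
    exact ⟨ψ, (isCellSolution_iff hB).2 hψ, val_im_eq_zero hψ'⟩
  · intro φ' hφ' hev' l ψ hψ
    exact fderiv_eigenfunction_sub_const (φ := φ') (ψ := ψ) hδ₀ hb hlam.differentiableAt hlam0
      (hcrit l) hφ' (hev'.mono fun η hη => ((isBlochEigenfunction_iff (φ := φ' η) hB).1 hη).2)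
      ((isCellSolution_iff (ψ := ψ) hB).1 hψ)
  · intro k l ψ hψ
    -- The given ψ may be complex; replacing it by a real solution leaves q unchanged. The Hessian
    -- is then the sum of two equal real terms, which cancels the factor 1/2.
    choose Ψ hΨ hΨ' using hcell
    have hre : ((homSum b Λ k l (Ψ l)).re : ℂ) = homSum b Λ k l (Ψ l) :=
      Complex.conj_eq_iff_re.1 (homSum_conj hsymm (hΨ' l))
    rw [approxHom_eq hB k l ψ,
      homSum_eq_of_cell hδ₀ hb ((isCellSolution_iff (ψ := ψ) hB).1 hψ) (hΨ l), hhess k l,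
      pderiv_meanFlux hδ₀ hb hφ hφ0 (hderiv k) (hΨ k),
      pderiv_meanFlux hδ₀ hb hφ hφ0 (hderiv l) (hΨ l),
      homSum_symm hsymm (hΨ l) (hΨ k) (hΨ' l)]
    conv_rhs => rw [← hre]
    push_cast
    ring
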